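/- Let $X$ be a finite alphabet with at least two letters. An invertible automaton over $X$ consists of a set of states $\mathcal A$, a transition function $\lambda:\mathcal A\times X\to\mathcal A$ and, for every state $s$, a permutation $\pi(s,\cdot)$ of $X$; its Moore diagram has an arrow $s\to\lambda(s,x)$ for every state $s$ and letter $x$ (arrows given by different letters are different). Every state acts on the space $X^\omega$ of right-infinite words by $s(xw)=\pi(s,x)\,\lambda(s,x)(w)$, and a set of states generates a group of transformations of $X^\omega$. A subset $\mathcal B\subset\mathcal A$ is a subautomaton if $\lambda(s,x)\in\mathcal B$ for all $s\in\mathcal B$, $x\in X$. A cycle is a simple directed cycle of the Moore diagram (a cycle is determined by its arrows). For a transformation $g$ in such a group and a finite word $v$, the restriction $g|_v$ is defined by $g(vw)=u\,g|_v(w)$ for all $w\in X^\omega$, where $|u|=|v|$; the group is contracting if it contains a finite set $\mathcal N$ such that for every element $g$ there is $n$ with $g|_v\in\mathcal N$ for all words $v$ with $|v|\ge n$. Let $\mathcal A$ be a finite invertible automaton over $X$ that is minimized (different states act differently on $X^\omega$), and let $\mathcal B$ be a subautomaton such that different cycles in $\mathcal A\setminus\mathcal B$ are disjoint (have no common state)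 and the group generated by $\mathcal B$ is contracting. Let $m$ be the maximal number of different cycles in $\mathcal A\setminus\mathcal B$ connected by a directed path, i.e. such that some directed path passes through all of them. Let $G$ be the group generated by $\mathcal A$ and let $T$ be a finite generating set of $G$. For $w\in X^\omega$ let $\Gamma_w$ be the orbital Schreier graph: its vertices are the points of the orbit $G(w)$, and $a,b$ are adjacent if $t(a)=b$ for some $t\in T\cup T^{-1}$. Then there exists a constant $C>0$ such that for every $w\in X^\omega$ and every vertex $v$ of $\Gamma_w$ the number $\gamma_v(n)$ of vertices in the closed ball of radius $n$ centred at $v$ is finite, the growth of $\gamma_v$ is subexponential, and $$\gamma_v(n)\le |X|^{C(\log n)^{m+1}}\qquad\text{for all } n\ge 0,$$ where $\log$ has base $2$ with the convention $\log 0=\log 1=1$. Here, for $f,g:\mathbb N\to\mathbb R$, $f\prec g$ means that $f(n)\le g(cn)$ for all $n$ and some positive integer $c$, and $f$ is subexponential if, for $a>1$, $f\prec a^n$ but not $a^n\prec f$. -/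

import Mathlib

/-- An invertible automaton with state set `S` over the alphabet `X`: reading the letter `x` in the
state `s` it outputs `out s x` and moves to the state `trans s x`; every `out s` is a
permutation of `X`.  Its Moore diagram has an arrow from `s` to `trans s x` for every pair
`(s, x)`, and arrows are identified with such pairs below. -/
structure InvAutomaton (S : Type*) (X : Type*) where
  trans : S → X → S
  out : S → Equiv.Perm X

namespace InvAutomaton

variable {S X : Type*} (A : InvAutomaton S X)

/-- The state `s|_v` reached from `s` by reading the finite word `v`. -/
def restr : S → List X → S
  | s, [] => s
  | s, x :: v => restr (A.trans s x) v

/-- The state reached from `s` after reading the first `n` letters of the infinite word `w`. -/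
def stateAt (s : S) (w : Stream' X) : ℕ → S
  | 0 => s
  | n + 1 => A.trans (stateAt s w n) (w.get n)

/-- The image `s(w)` of the infinite word `w` under the state `s`. -/
def act (s : S) (w : Stream' X) : Stream' X :=
  fun n => A.out (A.stateAt s w n) (w.get n)

/-- The state reached from `s` after outputting the first `n` letters of `w`. -/
def coStateAt (s : S) (w : Stream' X) : ℕ → S
  | 0 => s
  | n + 1 => A.trans (coStateAt s w n) ((A.out (coStateAt s w n)).symm (w.get n))

/-- The infinite word whose image under `s` is `w`. -/
def invAct (s : S) (w : Stream' X) : Stream' X :=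
  fun n => (A.out (A.coStateAt s w n)).symm (w.get n)

theorem coStateAt_act (s : S) (w : Stream' X) (n : ℕ) :
    A.coStateAt s (A.act s w) n = A.stateAt s w n := by
  induction n with
  | zero => rfl
  | succ n ih => simp [coStateAt, stateAt, ih, act, Stream'.get]

theorem stateAt_invAct (s : S) (w : Stream' X) (n : ℕ) :
    A.stateAt s (A.invAct s w) n = A.coStateAt s w n := by
  induction n with
  | zero => rfl
  | succ n ih => simp [coStateAt, stateAt, ih, invAct, Stream'.get]

/-- The transformation of the space of infinite words defined by the state `s`. -/
def perm (s : S) : Equiv.Perm (Stream' X) where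
  toFun := A.act s
  invFun := A.invAct s
  left_inv w := by
    funext n
    simp [invAct, Stream'.get, coStateAt_act]
    simp [act, Stream'.get]
  right_inv w := by
    funext n
    simp [act, Stream'.get, stateAt_invAct]
    simp [invAct, Stream'.get]

/-- Different states act differently on infinite words. -/
def Minimized : Prop := Function.Injective A.perm

/-- The group of transformations of infinite words generated by a set `B` of states. -/
def groupOf (B : Set S) : Subgroup (Equiv.Perm (Stream' X)) := Subgroup.closure (A.perm '' B)

/-- The automaton group generated by (all states of) `A`. -/
def group : Subgroup (Equiv.Perm (Stream' X)) := A.groupOf Set.univ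

/-- `B` is the state set of a subautomaton. -/
def IsSubautomaton (B : Set S) : Prop := ∀ s ∈ B, ∀ x, A.trans s x ∈ B

/-- `E` is the set of arrows of a simple directed cycle of the Moore diagram
(addition in `Fin (k + 1)` is cyclic). -/
def IsCycle (E : Set (S × X)) : Prop :=
  ∃ (k : ℕ) (σ : Fin (k + 1) → S) (x : Fin (k + 1) → X), Function.Injective σ ∧
    (∀ i, A.trans (σ i) (x i) = σ (i + 1)) ∧ E = Set.range fun i => (σ i, x i)

/-- The states lying on a cycle with set of arrows `E`. -/
def states (E : Set (S × X)) : Set S := Prod.fst '' E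

/-- `E` is a simple directed cycle all of whose states are outside `B`. -/
def IsCycleOutside (B : Set S) (E : Set (S × X)) : Prop := A.IsCycle E ∧ states E ⊆ Bᶜ

/-- Different cycles outside `B` have no common state. -/
def DisjointCyclesOutside (B : Set S) : Prop :=
  ∀ E F, A.IsCycleOutside B E → A.IsCycleOutside B F → E ≠ F → Disjoint (states E) (states F)

/-- The cycles of the family `𝓔` are connected by a directed path: some directed path (given by
its initial state `s` and the word `v` read along it) passes through all of them. -/
def ConnectedByPath (𝓔 : Finset (Set (S × X))) : Prop :=
  ∃ (s : S) (v : List X), ∀ E ∈ 𝓔, ∃ u : List X, u <+: v ∧ A.restr s u ∈ states E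

/-- `m` is the maximal number of different cycles outside `B` connected by a directed path. -/
def IsMaxConnectedCycles (B : Set S) (m : ℕ) : Prop :=
  IsGreatest {k : ℕ | ∃ 𝓔 : Finset (Set (S × X)),
    (∀ E ∈ 𝓔, A.IsCycleOutside B E) ∧ A.ConnectedByPath 𝓔 ∧ 𝓔.card = k} m

end InvAutomaton

section SelfSimilar

variable {X : Type*}

/-- `h` is the restriction `g|_v`: there is a word `u` of the same length as `v` with
`g(vw) = u h(w)` for every infinite word `w`. -/
def IsRestriction (g : Equiv.Perm (Stream' X)) (v : List X) (h : Equiv.Perm (Stream' X)) : Prop :=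
  ∃ u : List X, u.length = v.length ∧ ∀ w : Stream' X, g (v ++ₛ w) = u ++ₛ h w

/-- The group `G` of transformations of infinite words is contracting: there is a finite set
`N ⊆ G` such that for every `g ∈ G` all restrictions `g|_v` at long enough words `v`
lie in `N`. -/
def IsContracting (G : Subgroup (Equiv.Perm (Stream' X))) : Prop :=
  ∃ N : Set (Equiv.Perm (Stream' X)), N.Finite ∧ N ⊆ G ∧
    ∀ g ∈ G, ∃ n : ℕ, ∀ v : List X, n ≤ v.length → ∃ h ∈ N, IsRestriction g v h

/-- The orbital Schreier graph of `G` with respect to `T` at the infinite word `w`: its vertex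
set is the orbit of `w` under `G`, and different vertices `a`, `b` are adjacent if `t a = b` for
some `t ∈ T ∪ T⁻¹`. -/
def schreierGraph (G : Subgroup (Equiv.Perm (Stream' X))) (T : Set (Equiv.Perm (Stream' X)))
    (w : Stream' X) : SimpleGraph (MulAction.orbit G w) where
  Adj a b := a ≠ b ∧ ∃ t : Equiv.Perm (Stream' X), (t ∈ T ∨ t⁻¹ ∈ T) ∧ t a.1 = b.1
  symm := ⟨by
    rintro a b ⟨hab, t, ht, h⟩
    refine ⟨hab.symm, t⁻¹, ?_, ?_⟩
    · rw [inv_inv]; exact ht.symm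
    · rw [← h]; simp⟩
  loopless := ⟨fun _ h => h.1 rfl⟩

end SelfSimilar

section Growth

/-- The closed ball of radius `n` around the vertex `v`. -/
def graphBall {V : Type*} (Γ : SimpleGraph V) (v : V) (n : ℕ) : Set V := {u | Γ.edist v u ≤ n}

/-- The growth function of a (locally finite) graph with respect to the vertex `v`. -/
noncomputable def growthFun {V : Type*} (Γ : SimpleGraph V) (v : V) (n : ℕ) : ℝ :=
  (graphBall Γ v n).ncard

/-- `f` has growth not greater than `g`. -/
def GrowthLE (f g : ℕ → ℝ) : Prop := ∃ C : ℕ, 0 < C ∧ ∀ n, f n ≤ g (C * n)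

/-- The growth of `f` is not greater than the exponential growth and not equivalent to it. (All
functions `a ^ n` with `a > 1` are equivalent.) -/
def SubexponentialGrowth (f : ℕ → ℝ) : Prop :=
  ∀ a : ℝ, 1 < a → GrowthLE f (fun n => a ^ n) ∧
    ¬ (GrowthLE f (fun n => a ^ n) ∧ GrowthLE (fun n => a ^ n) f)

/-- The logarithm with base `2`, with the convention `log 0 = log 1 = 1`. -/
noncomputable def log₂ (n : ℕ) : ℝ := if n ≤ 1 then 1 else Real.logb 2 n

end Growth

/-! Give a state level at most `k` if every path from it meets at most `k` cycles outside `B`. Since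
these cycles are disjoint, a state on a cycle has only one letter that keeps it on the cycle; any
other letter lowers the level for good. So a letter `s` or `s⁻¹` of level `k + 1`, after a bounded
number of input letters, either has lower level or follows a single infinite word of a finite set
`P`, dropping as soon as the input leaves that word. Level `0` ends in the nucleus of the
contracting group. `LetterHierarchy` records exactly these facts.

The main point is synchronization: a product of `n` letters of level at most `k` itself reaches,
within time `O((log n)^(k+1))`, a restriction that is in the nucleus or follows one word of `P`
(`LetterHierarchy.exists_syncTime`). Two synchronized neighbours that survive long enough must
follow compatible words, because distinct words of the finite set `P` differ early; hence they merge
(`exists_mergeTime`). Lower-level words between blocks synchronize by induction and are absorbed, so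
each round halves the number of blocks. This takes `log n` rounds, each costing the synchronization
time of the previous level up to constants.

To count images of a word `w`, guess the synchronization time and the output up to then. Afterwards
the output comes from the nucleus, or lies in `P`, or copies a word of `P` up to the departure and
then comes from a product of lower level. Induction on the level gives `|X| ^ O((log n)^(m+1))`
images (`exists_orbitBound`), which bounds balls because radius `n` involves products of `O(n)`
letters. -/

open scoped Pointwise

/-! ### Tree automorphisms and their restrictions along infinite words. -/

section TreeAutomorphisms

variable {X : Type*}

/-- The infinite words `w` and `z` have the same first `n` letters. -/
def AgreeTo (n : ℕ) (w z : Stream' X) : Prop := ∀ i < n, w i = z i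

namespace AgreeTo

theorem symm {n : ℕ} {w z : Stream' X} (h : AgreeTo n w z) : AgreeTo n z w :=
  fun i hi => (h i hi).symm

theorem trans {n : ℕ} {w z y : Stream' X} (h : AgreeTo n w z) (h' : AgreeTo n z y) :
    AgreeTo n w y := fun i hi => (h i hi).trans (h' i hi)

theorem mono {n k : ℕ} {w z : Stream' X} (h : AgreeTo n w z) (hk : k ≤ n) : AgreeTo k w z :=
  fun i hi => h i (hi.trans_le hk)

end AgreeTo

/-- The infinite word `w` without its first `t` letters. -/
def shift (t : ℕ) (w : Stream' X) : Stream' X := fun i => w (t + i)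

/-- The infinite word formed by the first `t` letters of `w` followed by `z`. -/
def splice (t : ℕ) (w z : Stream' X) : Stream' X := fun i => if i < t then w i else z (i - t)

theorem splice_apply_of_lt {t : ℕ} (w z : Stream' X) {i : ℕ} (h : i < t) : splice t w z i = w i :=
  if_pos h

theorem splice_apply_add (t : ℕ) (w z : Stream' X) (i : ℕ) : splice t w z (t + i) = z i := by
  simp [splice]

@[simp] theorem shift_splice (t : ℕ) (w z : Stream' X) : shift t (splice t w z) = z := by
  funext i
  simp [shift, splice]

@[simp] theorem splice_shift (t : ℕ) (w : Stream' X) : splice t w (shift t w) = w := by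
  funext i
  by_cases h : i < t
  · simp [splice, h]
  · simp [splice, h, shift, Nat.add_sub_cancel' (not_lt.1 h)]

theorem agreeTo_splice (t : ℕ) (w z : Stream' X) : AgreeTo t (splice t w z) w :=
  fun _ hi => splice_apply_of_lt w z hi

theorem splice_congr {t : ℕ} {w w' : Stream' X} (h : AgreeTo t w w') (z : Stream' X) :
    splice t w z = splice t w' z := by
  funext i
  by_cases hi : i < t
  · simp [splice, hi, h i hi]
  · simp [splice, hi]

theorem shift_shift (t s : ℕ) (w : Stream' X) : shift s (shift t w) = shift (t + s) w := by
  funext i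
  simp [shift, add_assoc]

@[simp] theorem shift_zero (w : Stream' X) : shift 0 w = w := by
  funext i
  simp [shift]

theorem agreeTo_add {t s : ℕ} {w z : Stream' X} :
    AgreeTo (t + s) w z ↔ AgreeTo t w z ∧ AgreeTo s (shift t w) (shift t z) := by
  constructor
  · exact fun h => ⟨h.mono (Nat.le_add_right _ _), fun i hi => h _ (by omega)⟩
  · rintro ⟨h, h'⟩ i hi
    by_cases hit : i < t
    · exact h i hit
    · have := h' (i - t) (by omega)
      simpa [shift, Nat.add_sub_cancel' (not_lt.1 hit)] using this

theorem splice_add (t s : ℕ) (w z : Stream' X) :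
    splice (t + s) w z = splice t w (splice s (shift t w) z) := by
  funext i
  by_cases h : i < t
  · simp [splice, h, h.trans_le (Nat.le_add_right t s)]
  · by_cases h' : i < t + s
    · have : i - t < s := by omega
      simp [splice, h, h', this, shift, Nat.add_sub_cancel' (not_lt.1 h)]
    · have : ¬ i - t < s := by omega
      simp [splice, h, h', this, Nat.sub_sub]

variable (X) in
/-- The group of automorphisms of the rooted tree of finite words, as a group of transformations
of the space of infinite words. -/
def treeAut : Subgroup (Equiv.Perm (Stream' X)) where
  carrier := {g | ∀ n w z, AgreeTo n w z ↔ AgreeTo n (g w) (g z)}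
  mul_mem' {g h} hg hh n w z := (hh n w z).trans (hg n (h w) (h z))
  one_mem' _ _ _ := Iff.rfl
  inv_mem' {g} hg n w z := by
    have := hg n (g⁻¹ w) (g⁻¹ z)
    simpa using this.symm

theorem agreeTo_smul (g : treeAut X) {n : ℕ} {w z : Stream' X} :
    AgreeTo n (g • w) (g • z) ↔ AgreeTo n w z := (g.2 n w z).symm

theorem splice_smul_shift (g : treeAut X) (w z : Stream' X) (t : ℕ) :
    splice t (g • w) (shift t (g • splice t w z)) = g • splice t w z := by
  rw [splice_congr ((agreeTo_smul g).2 (agreeTo_splice t w z).symm), splice_shift]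

/-- The restriction of `g` at the word formed by the first `t` letters of `w`. -/
def res (g : treeAut X) (w : Stream' X) (t : ℕ) : treeAut X where
  val :=
    { toFun := fun z => shift t (g • splice t w z)
      invFun := fun z => shift t (g⁻¹ • splice t (g • w) z)
      left_inv := fun z => by simp [splice_smul_shift]
      right_inv := fun z => by
        have := splice_smul_shift g⁻¹ (g • w) z t
        rw [inv_smul_smul] at this
        simp [this] }
  property n z y := by
    have h : AgreeTo (t + n) (splice t w z) (splice t w y) ↔ AgreeTo n z y := by
      rw [agreeTo_add]
      simp only [shift_splice, and_iff_right_iff_imp]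
      exact fun _ => (agreeTo_splice t w z).trans (agreeTo_splice t w y).symm
    rw [← h, ← agreeTo_smul g, agreeTo_add]
    simp only [Equiv.coe_fn_mk, and_iff_right_iff_imp]
    exact fun _ => (agreeTo_smul g).2 ((agreeTo_splice t w z).trans (agreeTo_splice t w y).symm)

theorem res_smul (g : treeAut X) (w z : Stream' X) (t : ℕ) :
    res g w t • z = shift t (g • splice t w z) := rfl

theorem treeAut_ext {g h : treeAut X} (H : ∀ z : Stream' X, g • z = h • z) : g = h :=
  Subtype.ext (Equiv.ext H)

theorem shift_smul (g : treeAut X) (w : Stream' X) (t : ℕ) :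
    shift t (g • w) = res g w t • shift t w := by
  rw [res_smul, splice_shift]

theorem splice_smul (g : treeAut X) (w z : Stream' X) (t : ℕ) :
    g • splice t w z = splice t (g • w) (res g w t • z) := by
  rw [res_smul, splice_smul_shift]

theorem smul_eq_splice (g : treeAut X) (w : Stream' X) (t : ℕ) :
    g • w = splice t (g • w) (res g w t • shift t w) := by
  rw [← shift_smul, splice_shift]

theorem res_congr (g : treeAut X) {w z : Stream' X} {t : ℕ} (h : AgreeTo t w z) :
    res g w t = res g z t :=
  treeAut_ext fun y => by rw [res_smul, res_smul, splice_congr h]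

theorem res_mul (g h : treeAut X) (w : Stream' X) (t : ℕ) :
    res (g * h) w t = res g (h • w) t * res h w t :=
  treeAut_ext fun z => by
    rw [mul_smul, res_smul, res_smul, mul_smul, splice_smul h]

@[simp] theorem res_one (w : Stream' X) (t : ℕ) : res (1 : treeAut X) w t = 1 :=
  treeAut_ext fun z => by simp [res_smul]

theorem res_inv (g : treeAut X) (w : Stream' X) (t : ℕ) :
    res g⁻¹ w t = (res g (g⁻¹ • w) t)⁻¹ := by
  have := res_mul g g⁻¹ w t
  rw [mul_inv_cancel, res_one] at this
  exact eq_inv_of_mul_eq_one_right this.symm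

theorem res_add (g : treeAut X) (w : Stream' X) (t s : ℕ) :
    res g w (t + s) = res (res g w t) (shift t w) s :=
  treeAut_ext fun z => by
    rw [res_smul, res_smul, res_smul, shift_shift, splice_add]

@[simp] theorem res_zero (g : treeAut X) (w : Stream' X) : res g w 0 = g :=
  treeAut_ext fun z => by
    have : splice 0 w z = z := by funext i; simp [splice]
    rw [res_smul, shift_zero, this]

end TreeAutomorphisms

/-! ### Abstract letter hierarchies and synchronized transformations. -/

/-- A finite nucleus `N`, a finite set `P` of infinite words, and sets `L k` of letters of level at
most `k` closed under restrictions, such that after reading `c` letters of input a letter of level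
`k + 1` either drops to level `k` or drops to level `k` as soon as the input departs from a certain
word of `P`. -/
structure LetterHierarchy (X : Type*) where
  N : Set (treeAut X)
  P : Set (Stream' X)
  L : ℕ → Set (treeAut X)
  c : ℕ
  d : ℕ
  finite_N : N.Finite
  finite_P : P.Finite
  one_mem_N : 1 ∈ N
  inv_mem_N : ∀ g ∈ N, g⁻¹ ∈ N
  res_mem_N : ∀ g ∈ N, ∀ w t, res g w t ∈ N
  res_mul_mem_N : ∀ g ∈ N, ∀ h ∈ N, ∀ w, res (g * h) w d ∈ N
  shift_mem_P : ∀ p ∈ P, ∀ t, shift t p ∈ P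
  shift_smul_mem_P : ∀ g ∈ N, ∀ p ∈ P, shift d (g • p) ∈ P
  N_subset_L : N ⊆ L 0
  L_subset_succ : ∀ k, L k ⊆ L (k + 1)
  res_mem_L : ∀ k, ∀ g ∈ L k, ∀ w t, res g w t ∈ L k
  res_L_zero : ∀ g ∈ L 0, ∀ w, res g w c ∈ N
  res_L_succ : ∀ k, ∀ g ∈ L (k + 1), ∀ w, res g w c ∈ L k ∨
    ∃ p ∈ P, res g w c • p ∈ P ∧ ∀ z t, ¬ AgreeTo t z p → res (res g w c) z t ∈ L k

namespace LetterHierarchy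

variable {X : Type*} (H : LetterHierarchy X)

theorem L_mono : Monotone H.L := monotone_nat_of_le_succ H.L_subset_succ

theorem one_mem_L (k : ℕ) : 1 ∈ H.L k :=
  H.L_mono (Nat.zero_le k) (H.N_subset_L H.one_mem_N)

theorem N_subset (k : ℕ) : H.N ⊆ H.L k := fun _ hg => H.L_mono (Nat.zero_le k) (H.N_subset_L hg)

theorem res_mem_pow {k l : ℕ} {g : treeAut X} (hg : g ∈ H.L k ^ l) (w : Stream' X) (t : ℕ) :
    res g w t ∈ H.L k ^ l := by
  induction l generalizing g w with
  | zero =>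
    rw [pow_zero, Set.mem_one] at hg ⊢
    rw [hg, res_one]
  | succ l ih =>
    rw [pow_succ] at hg ⊢
    obtain ⟨a, ha, b, hb, rfl⟩ := Set.mem_mul.1 hg
    rw [res_mul]
    exact Set.mul_mem_mul (ih ha _) (H.res_mem_L k b hb _ _)

theorem pow_mono {j k l : ℕ} (h : j ≤ k) : H.L j ^ l ⊆ H.L k ^ l :=
  Set.pow_subset_pow_left (H.L_mono h)

/-- The words of `l` letters of level less than `j`. -/
def lower : ℕ → ℕ → Set (treeAut X)
  | 0, _ => ∅
  | j + 1, l => H.L j ^ l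

theorem lower_mono {j k l : ℕ} (h : j ≤ k) : H.lower j l ⊆ H.lower k l := by
  cases j with
  | zero => exact Set.empty_subset _
  | succ j =>
    cases k with
    | zero => omega
    | succ k => exact H.pow_mono (Nat.le_of_succ_le_succ h)

theorem mul_mem_lower {j l l' : ℕ} {g h : treeAut X} (hg : g ∈ H.lower j l)
    (hh : h ∈ H.lower j l') : g * h ∈ H.lower j (l + l') := by
  cases j with
  | zero => exact hg.elim
  | succ j =>
    change _ ∈ H.L j ^ (l + l')
    rw [pow_add]
    exact Set.mul_mem_mul hg hh

theorem N_subset_pow {k l : ℕ} (hl : 1 ≤ l) : H.N ⊆ H.L k ^ l := fun g hg =>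
  Set.pow_subset_pow_right (H.one_mem_L k) hl (by rw [pow_one]; exact H.N_subset k hg)

theorem N_mul_mem_lower {j l l' : ℕ} {g h : treeAut X} (hl : 1 ≤ l) (hg : g ∈ H.N)
    (hh : h ∈ H.lower j l') : g * h ∈ H.lower j (l + l') := by
  cases j with
  | zero => exact hh.elim
  | succ j => exact H.mul_mem_lower (H.N_subset_pow hl hg) hh

theorem mul_N_mem_lower {j l l' : ℕ} {g h : treeAut X} (hl : 1 ≤ l') (hg : g ∈ H.lower j l)
    (hh : h ∈ H.N) : g * h ∈ H.lower j (l + l') := by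
  cases j with
  | zero => exact hg.elim
  | succ j => exact H.mul_mem_lower hg (H.N_subset_pow hl hh)

/-- As soon as the input departs from `p`, the transformation `g` becomes a word of `l` letters of
level less than `j`. -/
def DropsOff (j l : ℕ) (g : treeAut X) (p : Stream' X) : Prop :=
  ∀ z t, ¬ AgreeTo t z p → res g z t ∈ H.lower j l

variable {H}

theorem DropsOff.res {j l : ℕ} {g : treeAut X} {p : Stream' X} (h : H.DropsOff j l g p) (t : ℕ) :
    H.DropsOff j l (res g p t) (shift t p) := by
  intro z s hz
  have := h (splice t p z) (t + s) (fun h' => hz (by simpa using (agreeTo_add.1 h').2))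
  rwa [res_add, res_congr g (agreeTo_splice t p z), shift_splice] at this

theorem DropsOff.mono {j k l : ℕ} {g : treeAut X} {p : Stream' X} (h : H.DropsOff j l g p)
    (hjk : j ≤ k) : H.DropsOff k l g p := fun z t hz => H.lower_mono hjk (h z t hz)

theorem DropsOff.mul {j l l' : ℕ} {g h : treeAut X} {p : Stream' X}
    (hg : H.DropsOff j l g (h • p)) (hh : H.DropsOff j l' h p) :
    H.DropsOff j (l + l') (g * h) p := by
  intro z t hz
  rw [res_mul]
  exact H.mul_mem_lower (hg _ _ (by rwa [agreeTo_smul])) (hh _ _ hz)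

theorem DropsOff.N_mul {j l l' : ℕ} {g h : treeAut X} {p : Stream' X} (hl : 1 ≤ l)
    (hg : g ∈ H.N) (hh : H.DropsOff j l' h p) : H.DropsOff j (l + l') (g * h) p := by
  intro z t hz
  rw [res_mul]
  exact H.N_mul_mem_lower hl (H.res_mem_N g hg _ _) (hh _ _ hz)

/-- The factor `h` acts first, so `g` sees the word `p` exactly when the input of the product is
`h⁻¹ • p`. -/
theorem DropsOff.mul_N {j l l' : ℕ} {g h : treeAut X} {p : Stream' X} (hl : 1 ≤ l')
    (hg : H.DropsOff j l g p) (hh : h ∈ H.N) : H.DropsOff j (l + l') (g * h) (h⁻¹ • p) := by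
  intro z t hz
  rw [res_mul]
  refine H.mul_N_mem_lower hl (hg _ _ fun h' => hz ?_) (H.res_mem_N h hh _ _)
  rwa [← agreeTo_smul h, smul_inv_smul]

variable (H)

/-- The transformation `g` either belongs to the nucleus or drops off a word of `P` to words of
`l` letters of level less than `j`. -/
def IsSync (j l : ℕ) (g : treeAut X) : Prop :=
  1 ≤ l ∧ (g ∈ H.N ∨ ∃ p ∈ H.P, g • p ∈ H.P ∧ H.DropsOff j l g p)

variable {H}

theorem IsSync.mono {j k l : ℕ} {g : treeAut X} (h : H.IsSync j l g) (hjk : j ≤ k) :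
    H.IsSync k l g :=
  ⟨h.1, h.2.imp_right fun ⟨p, hp, hgp, h'⟩ => ⟨p, hp, hgp, h'.mono hjk⟩⟩

/-- While the input follows `p`, the restriction follows the shifted word; once it departs,
`DropsOff` applies. -/
theorem IsSync.res {j l : ℕ} {g : treeAut X} (h : H.IsSync j l g) (w : Stream' X) (t : ℕ) :
    H.IsSync j l (res g w t) ∨ _root_.res g w t ∈ H.lower j l := by
  obtain ⟨hl, h | ⟨p, hp, hgp, hd⟩⟩ := h
  · exact Or.inl ⟨hl, Or.inl (H.res_mem_N g h w t)⟩
  · by_cases hw : AgreeTo t w p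
    · refine Or.inl ⟨hl, Or.inr ⟨shift t p, H.shift_mem_P p hp t, ?_, ?_⟩⟩
      · rw [res_congr g hw, ← shift_smul]
        exact H.shift_mem_P _ hgp t
      · rw [res_congr g hw]
        exact hd.res t
    · exact Or.inr (hd _ _ hw)

/-! ### Merging two synchronized transformations. -/

variable (H)

theorem exists_agreeTo_imp_eq : ∃ M, ∀ p ∈ H.P, ∀ q ∈ H.P, AgreeTo M p q → p = q := by
  have key : ∀ p ∈ H.P, ∀ q ∈ H.P, ∀ᶠ M in Filter.atTop, AgreeTo M p q → p = q := by
    intro p _ q _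
    by_cases h : p = q
    · exact Filter.Eventually.of_forall fun _ _ => h
    · obtain ⟨i, hi⟩ : ∃ i, p i ≠ q i := by
        by_contra! h'
        exact h (funext h')
      filter_upwards [Filter.eventually_gt_atTop i] with M hM h'
      exact absurd (h' i hM) hi
  have := (Filter.eventually_all_finite H.finite_P).2 fun p hp =>
    (Filter.eventually_all_finite H.finite_P).2 fun q hq => key p hp q hq
  exact this.exists

theorem res_mul_mem_N_of_le {g h : treeAut X} (hg : g ∈ H.N) (hh : h ∈ H.N) (w : Stream' X)
    {t : ℕ} (ht : H.d ≤ t) : res (g * h) w t ∈ H.N := by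
  rw [← Nat.add_sub_cancel' ht, res_add]
  exact H.res_mem_N _ (H.res_mul_mem_N g hg h hh w) _ _

theorem shift_smul_mem_P_of_le {g : treeAut X} (hg : g ∈ H.N) {p : Stream' X} (hp : p ∈ H.P)
    {t : ℕ} (ht : H.d ≤ t) : shift t (g • p) ∈ H.P := by
  rw [← Nat.add_sub_cancel' ht, ← shift_shift]
  exact H.shift_mem_P _ (H.shift_smul_mem_P g hg p hp) _

/-- `M` is a time within which two synchronized transformations merge or one of them drops. -/
def MergeTime (M : ℕ) : Prop :=
  ∀ {i j k l l' : ℕ} {g h : treeAut X}, i ≤ k → j ≤ k →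
    H.IsSync i l g → H.IsSync j l' h → ∀ w, H.IsSync k (l + l') (res (g * h) w M) ∨
      res g (h • w) M ∈ H.lower i l ∨ res h w M ∈ H.lower j l'

/-- If neither factor drops, the output word `h • q` of the right factor and the input word `p` of
the left one share a long prefix; both lie in the finite set `P`, so they coincide and the product
follows `q`. Nucleus factors only transport the followed word. -/
theorem exists_mergeTime : ∃ M, H.MergeTime M := by
  obtain ⟨M₀, hM₀⟩ := H.exists_agreeTo_imp_eq
  -- `M₀` letters tell the words of `P` apart; `d` letters bring products of nucleus elements back
  -- to `N`, and images of `P` under `N` back to `P`.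
  refine ⟨M₀ + H.d, ?_⟩
  intro i j k l l' g h hik hjk hg hh w
  have hd : H.d ≤ M₀ + H.d := Nat.le_add_left _ _
  obtain ⟨hl, hg⟩ := hg
  obtain ⟨hl', hh⟩ := hh
  set M := M₀ + H.d with hM
  have along : ∀ p, AgreeTo M w p → H.DropsOff k (l + l') (g * h) p → shift M p ∈ H.P →
      shift M ((g * h) • p) ∈ H.P → H.IsSync k (l + l') (res (g * h) w M) := by
    intro p hw hdp hp hgp
    refine ⟨by omega, Or.inr ⟨shift M p, hp, ?_, ?_⟩⟩
    · rwa [res_congr _ hw, ← shift_smul]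
    · rw [res_congr _ hw]
      exact hdp.res M
  rcases hg with hg | ⟨p, hp, hgp, hdp⟩
  · rcases hh with hh | ⟨q, hq, hhq, hdq⟩
    · exact Or.inl ⟨by omega, Or.inl (H.res_mul_mem_N_of_le hg hh w hd)⟩
    · by_cases hw : AgreeTo M w q
      · refine Or.inl (along q hw ((hdq.mono hjk).N_mul hl hg) (H.shift_mem_P q hq M) ?_)
        rw [mul_smul]
        exact H.shift_smul_mem_P_of_le hg hhq hd
      · exact Or.inr (Or.inr (hdq _ _ hw))
  · by_cases hw : AgreeTo M (h • w) p
    · rcases hh with hh | ⟨q, hq, hhq, hdq⟩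
      · refine Or.inl (along (h⁻¹ • p) ?_ ((hdp.mono hik).mul_N hl' hh)
          (H.shift_smul_mem_P_of_le (H.inv_mem_N h hh) hp hd) ?_)
        · rwa [← agreeTo_smul h, smul_inv_smul]
        · rw [mul_smul, smul_inv_smul]
          exact H.shift_mem_P _ hgp M
      · by_cases hwq : AgreeTo M w q
        · have hpq : h • q = p := by
            refine hM₀ _ hhq _ hp (AgreeTo.mono ?_ (Nat.le_add_right M₀ H.d))
            exact ((agreeTo_smul h).2 hwq.symm).trans hw
          refine Or.inl (along q hwq ?_ (H.shift_mem_P q hq M) ?_)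
          · exact DropsOff.mul (by rw [hpq]; exact hdp.mono hik) (hdq.mono hjk)
          · rw [mul_smul, hpq]
            exact H.shift_mem_P _ hgp M
        · exact Or.inr (Or.inr (hdq _ _ hwq))
    · exact Or.inr (Or.inl (hdp _ _ hw))

/-! ### Words split into synchronized blocks. -/

/-- `H.IsBlockWord k r l g`: the transformation `g` is a product of `l` letters that splits into
words of letters of level at most `k` and at most `r` synchronized blocks of level `k + 1`. -/
inductive IsBlockWord (k : ℕ) : ℕ → ℕ → treeAut X → Prop
  | low {r l : ℕ} {g : treeAut X} : g ∈ H.L k ^ l → IsBlockWord k r l g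
  | sync {r l : ℕ} {g : treeAut X} : H.IsSync (k + 1) l g → IsBlockWord k (r + 1) l g
  | mul {r r' l l' : ℕ} {g h : treeAut X} : IsBlockWord k r l g → IsBlockWord k r' l' h →
      IsBlockWord k (r + r') (l + l') (g * h)

variable {H}

namespace IsBlockWord

theorem res {k r l : ℕ} {g : treeAut X} (h : H.IsBlockWord k r l g) (w : Stream' X) (t : ℕ) :
    H.IsBlockWord k r l (res g w t) := by
  induction h generalizing w with
  | low h => exact low (H.res_mem_pow h w t)
  | sync h =>
    rcases h.res w t with h | h
    · exact sync h
    · exact low h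
  | mul _ _ ih ih' =>
    rw [res_mul]
    exact mul (ih _) (ih' _)

theorem mono {k r r' l : ℕ} {g : treeAut X} (h : H.IsBlockWord k r l g) (hr : r ≤ r') :
    H.IsBlockWord k r' l g := by
  induction h generalizing r' with
  | low h => exact low h
  | @sync r l g h =>
    obtain ⟨s, rfl⟩ : ∃ s, r' = s + 1 := ⟨r' - 1, by omega⟩
    exact sync h
  | @mul r₁ r₂ l l' g h _ _ ih ih' =>
    obtain ⟨s, rfl⟩ : ∃ s, r' = r₁ + s := ⟨r' - r₁, by omega⟩
    exact mul (ih le_rfl) (ih' (by omega))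

theorem mul_le {k r r' s l l' : ℕ} {g h : treeAut X} (hg : H.IsBlockWord k r l g)
    (hh : H.IsBlockWord k r' l' h) (hs : r + r' ≤ s) : H.IsBlockWord k s (l + l') (g * h) :=
  (mul hg hh).mono hs

theorem mem_pow {k r l : ℕ} {g : treeAut X} (h : H.IsBlockWord k r l g) (hr : r = 0) :
    g ∈ H.L k ^ l := by
  induction h with
  | low h => exact h
  | sync h => omega
  | mul _ _ ih ih' =>
    rw [pow_add]
    exact Set.mul_mem_mul (ih (by omega)) (ih' (by omega))

theorem split {k r s l : ℕ} {g : treeAut X} (h : H.IsBlockWord k r l g) (hs : r = s + 1) :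
    ∃ l₁ l₂ g₁ g₂, l = l₁ + l₂ ∧ g = g₁ * g₂ ∧ H.IsBlockWord k 1 l₁ g₁ ∧
      H.IsBlockWord k s l₂ g₂ := by
  induction h generalizing s with
  | @low r l g h => exact ⟨0, l, 1, g, by simp, by simp, low (by simp), low h⟩
  | @sync r l g h => exact ⟨l, 0, g, 1, by simp, by simp, sync (r := 0) h, low (by simp)⟩
  | @mul r r' l l' g h hg hh ih ih' =>
    rcases Nat.eq_zero_or_pos r with hr | hr
    · obtain ⟨l₁, l₂, g₁, g₂, hl, hh', h₁, h₂⟩ := ih' (s := s) (by omega)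
      exact ⟨l + l₁, l₂, g * g₁, g₂, by omega, by rw [hh', mul_assoc],
        hg.mul_le h₁ (by omega), h₂⟩
    · obtain ⟨l₁, l₂, g₁, g₂, hl, hg', h₁, h₂⟩ := ih (s := r - 1) (by omega)
      exact ⟨l₁, l₂ + l', g₁, g₂ * h, by omega, by rw [hg', mul_assoc], h₁,
        h₂.mul_le hh (by omega)⟩

theorem split_two {k s l : ℕ} {g : treeAut X} (h : H.IsBlockWord k (s + 2) l g) :
    ∃ l₁ l₂ g₁ g₂, l = l₁ + l₂ ∧ g = g₁ * g₂ ∧ H.IsBlockWord k 2 l₁ g₁ ∧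
      H.IsBlockWord k s l₂ g₂ := by
  obtain ⟨l₁, l₂, g₁, g₂, rfl, rfl, h₁, h₂⟩ := h.split (s := s + 1) rfl
  obtain ⟨l₃, l₄, g₃, g₄, rfl, rfl, h₃, h₄⟩ := h₂.split (s := s) rfl
  exact ⟨l₁ + l₃, l₄, g₁ * g₃, g₄, by omega, by rw [mul_assoc], mul h₁ h₃, h₄⟩

theorem eq_of_one {k r l : ℕ} {g : treeAut X} (h : H.IsBlockWord k r l g) (hr : r = 1) :
    g ∈ H.L k ^ l ∨ ∃ l₁ l₂ l₃ g₁ b g₃, l = l₁ + l₂ + l₃ ∧ g = g₁ * b * g₃ ∧ g₁ ∈ H.L k ^ l₁ ∧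
      H.IsSync (k + 1) l₂ b ∧ g₃ ∈ H.L k ^ l₃ := by
  induction h with
  | low h => exact Or.inl h
  | @sync r l g h =>
    exact Or.inr ⟨0, l, 0, 1, g, 1, by simp, by simp, by simp, h, by simp⟩
  | @mul r r' l l' g h hg hh ih ih' =>
    rcases Nat.eq_zero_or_pos r with hr' | hr'
    · have hg := hg.mem_pow hr'
      rcases ih' (by omega) with hh | ⟨l₁, l₂, l₃, g₁, b, g₃, rfl, rfl, h₁, h₂, h₃⟩
      · left
        rw [pow_add]
        exact Set.mul_mem_mul hg hh
      · refine Or.inr ⟨l + l₁, l₂, l₃, g * g₁, b, g₃, by omega, by simp only [mul_assoc], ?_,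
          h₂, h₃⟩
        rw [pow_add]
        exact Set.mul_mem_mul hg h₁
    · have hh := hh.mem_pow (by omega)
      rcases ih (by omega) with hg | ⟨l₁, l₂, l₃, g₁, b, g₃, rfl, rfl, h₁, h₂, h₃⟩
      · left
        rw [pow_add]
        exact Set.mul_mem_mul hg hh
      · refine Or.inr ⟨l₁, l₂, l₃ + l', g₁, b, g₃ * h, by omega, by simp only [mul_assoc], h₁,
          h₂, ?_⟩
        rw [pow_add]
        exact Set.mul_mem_mul h₃ hh

end IsBlockWord

variable (H)

/-- Words of at most `n` letters of level at most `k` get synchronized within time `K`. -/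
def SyncTime (k n K : ℕ) : Prop :=
  ∀ l, 1 ≤ l → l ≤ n → ∀ g ∈ H.L k ^ l, ∀ w, ∃ t ≤ K, H.IsSync k l (res g w t)

variable {H}

theorem SyncTime.mono {k n K K' : ℕ} (h : H.SyncTime k n K) (hK : K ≤ K') : H.SyncTime k n K' :=
  fun l hl hln g hg w =>
    let ⟨t, ht, h'⟩ := h l hl hln g hg w
    ⟨t, ht.trans hK, h'⟩

theorem mul_mem_pow {k l l' : ℕ} {g h : treeAut X} (hg : g ∈ H.L k ^ l) (hh : h ∈ H.L k ^ l') :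
    g * h ∈ H.L k ^ (l + l') := by
  rw [pow_add]
  exact Set.mul_mem_mul hg hh

/-! ### Absorbing low words and halving the number of blocks. -/

variable {k n K M : ℕ}

/-- Wait `K` for `u` to synchronize and `M` for the merger. If the merger fails, either `b` drops,
leaving only low letters, or `u` drops to level below `j` and the induction on `j` repeats the
argument. At `j = 0` the second outcome is void because `lower 0` is empty. -/
theorem sync_or_low_mul_right (hM : H.MergeTime M) (hK : ∀ j ≤ k, H.SyncTime j n K) {j : ℕ}
    (hj : j ≤ k) {l l' : ℕ} (hl' : l' ≤ n) {b u : treeAut X} (hb : H.IsSync (k + 1) l b)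
    (hu : u ∈ H.L j ^ l') (w : Stream' X) : ∃ t ≤ (j + 1) * (K + M),
      H.IsSync (k + 1) (l + l') (res (b * u) w t) ∨ res (b * u) w t ∈ H.L k ^ (l + l') := by
  rcases Nat.eq_zero_or_pos l' with rfl | hl0
  · refine ⟨0, Nat.zero_le _, Or.inl ?_⟩
    rw [pow_zero, Set.mem_one] at hu
    simpa [hu] using hb
  induction j generalizing b u w with
  | zero =>
    obtain ⟨t, ht, hut⟩ := hK 0 hj l' hl0 hl' u hu w
    rcases hb.res (u • w) t with hbt | hbt
    · refine ⟨t + M, by linarith, ?_⟩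
      rw [res_add]
      rcases hM le_rfl (Nat.zero_le _) hbt hut (shift t w) with h | h | h
      · rw [res_mul b u w t]
        exact Or.inl h
      · rw [res_mul b u w t, res_mul]
        exact Or.inr (mul_mem_pow h
          (H.res_mem_pow (H.pow_mono hj (H.res_mem_pow hu _ _)) _ _))
      · exact h.elim
    · refine ⟨t, by linarith, Or.inr ?_⟩
      rw [res_mul]
      exact mul_mem_pow hbt (H.pow_mono hj (H.res_mem_pow hu _ _))
  | succ j ih =>
    have e : (j + 1 + 1) * (K + M) = (j + 1) * (K + M) + (K + M) := by ring
    obtain ⟨t, ht, hut⟩ := hK _ hj l' hl0 hl' u hu w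
    rcases hb.res (u • w) t with hbt | hbt
    · rcases hM le_rfl (hj.trans (Nat.le_succ k)) hbt hut (shift t w) with h | h | h
      · refine ⟨t + M, by linarith [Nat.zero_le ((j + 1) * (K + M))], Or.inl ?_⟩
        rw [res_add, res_mul b u w t]
        exact h
      · refine ⟨t + M, by linarith [Nat.zero_le ((j + 1) * (K + M))], Or.inr ?_⟩
        rw [res_add, res_mul b u w t, res_mul]
        exact mul_mem_pow h (H.res_mem_pow (H.pow_mono hj (H.res_mem_pow hu _ _)) _ _)
      · rw [← res_add] at h
        rcases hb.res (u • w) (t + M) with hbt | hbt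
        · obtain ⟨s, hs, hs'⟩ := ih ((Nat.le_succ j).trans hj) hbt h (shift (t + M) w)
          refine ⟨t + M + s, by linarith, ?_⟩
          rwa [res_add, res_mul b u w (t + M)]
        · refine ⟨t + M, by linarith [Nat.zero_le ((j + 1) * (K + M))], Or.inr ?_⟩
          rw [res_mul]
          exact mul_mem_pow hbt (H.pow_mono hj (H.res_mem_pow hu _ _))
    · refine ⟨t, by linarith [Nat.zero_le ((j + 1) * (K + M))], Or.inr ?_⟩
      rw [res_mul]
      exact mul_mem_pow hbt (H.pow_mono hj (H.res_mem_pow hu _ _))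

theorem sync_or_low_mul_left (hM : H.MergeTime M) (hK : ∀ j ≤ k, H.SyncTime j n K) {j : ℕ}
    (hj : j ≤ k) {l l' : ℕ} (hl' : l' ≤ n) {b u : treeAut X} (hb : H.IsSync (k + 1) l b)
    (hu : u ∈ H.L j ^ l') (w : Stream' X) : ∃ t ≤ (j + 1) * (K + M),
      H.IsSync (k + 1) (l' + l) (res (u * b) w t) ∨ res (u * b) w t ∈ H.L k ^ (l' + l) := by
  rcases Nat.eq_zero_or_pos l' with rfl | hl0
  · refine ⟨0, Nat.zero_le _, Or.inl ?_⟩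
    rw [pow_zero, Set.mem_one] at hu
    simpa [hu] using hb
  induction j generalizing b u w with
  | zero =>
    obtain ⟨t, ht, hut⟩ := hK 0 hj l' hl0 hl' u hu (b • w)
    rcases hb.res w t with hbt | hbt
    · refine ⟨t + M, by linarith, ?_⟩
      rw [res_add]
      rcases hM (Nat.zero_le _) le_rfl hut hbt (shift t w) with h | h | h
      · rw [res_mul u b w t]
        exact Or.inl h
      · exact h.elim
      · rw [res_mul u b w t, res_mul]
        exact Or.inr (mul_mem_pow
          (H.res_mem_pow (H.pow_mono hj (H.res_mem_pow hu _ _)) _ _) h)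
    · refine ⟨t, by linarith, Or.inr ?_⟩
      rw [res_mul]
      exact mul_mem_pow (H.pow_mono hj (H.res_mem_pow hu _ _)) hbt
  | succ j ih =>
    have e : (j + 1 + 1) * (K + M) = (j + 1) * (K + M) + (K + M) := by ring
    obtain ⟨t, ht, hut⟩ := hK _ hj l' hl0 hl' u hu (b • w)
    rcases hb.res w t with hbt | hbt
    · rcases hM (hj.trans (Nat.le_succ k)) le_rfl hut hbt (shift t w) with h | h | h
      · refine ⟨t + M, by linarith [Nat.zero_le ((j + 1) * (K + M))], Or.inl ?_⟩
        rw [res_add, res_mul u b w t]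
        exact h
      · rw [← shift_smul, ← res_add] at h
        rcases hb.res w (t + M) with hbt | hbt
        · obtain ⟨s, hs, hs'⟩ := ih ((Nat.le_succ j).trans hj) hbt h (shift (t + M) w)
          refine ⟨t + M + s, by linarith, ?_⟩
          rwa [res_add, res_mul u b w (t + M)]
        · refine ⟨t + M, by linarith [Nat.zero_le ((j + 1) * (K + M))], Or.inr ?_⟩
          rw [res_mul]
          exact mul_mem_pow (H.pow_mono hj (H.res_mem_pow hu _ _)) hbt
      · refine ⟨t + M, by linarith [Nat.zero_le ((j + 1) * (K + M))], Or.inr ?_⟩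
        rw [res_add, res_mul u b w t, res_mul]
        exact mul_mem_pow (H.res_mem_pow (H.pow_mono hj (H.res_mem_pow hu _ _)) _ _) h
    · refine ⟨t, by linarith [Nat.zero_le ((j + 1) * (K + M))], Or.inr ?_⟩
      rw [res_mul]
      exact mul_mem_pow (H.pow_mono hj (H.res_mem_pow hu _ _)) hbt

/-- The left block absorbs the low word in the middle, after which the two blocks are adjacent and
have `M` steps to merge. Any drop on the way also removes a block. -/
theorem merge_two_blocks (hM : H.MergeTime M) (hK : ∀ j ≤ k, H.SyncTime j n K) {l₁ l₂ l₃ : ℕ}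
    (hl : l₂ ≤ n) {b u b' : treeAut X} (hb : H.IsSync (k + 1) l₁ b) (hu : u ∈ H.L k ^ l₂)
    (hb' : H.IsSync (k + 1) l₃ b') (w : Stream' X) :
    H.IsBlockWord k 1 (l₁ + l₂ + l₃) (res (b * u * b') w ((k + 1) * (K + M) + M)) := by
  -- Block words are closed under restriction, so reaching the goal early is enough.
  suffices h : ∃ t ≤ (k + 1) * (K + M) + M,
      H.IsBlockWord k 1 (l₁ + l₂ + l₃) (res (b * u * b') w t) by
    obtain ⟨t, ht, h⟩ := h
    rw [← Nat.add_sub_cancel' ht, res_add]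
    exact h.res _ _
  obtain ⟨t, ht, h⟩ := sync_or_low_mul_right hM hK le_rfl hl hb hu (b' • w)
  rcases h with h | h
  · rcases hb'.res w t with h' | h'
    · refine ⟨t + M, by omega, ?_⟩
      rw [res_add]
      rcases hM le_rfl le_rfl h h' (shift t w) with h₀ | h₀ | h₀
      · rw [res_mul (b * u) b' w t]
        exact .sync (r := 0) h₀
      · rw [res_mul (b * u) b' w t, res_mul]
        exact (IsBlockWord.low (r := 0) h₀).mul_le ((IsBlockWord.sync (r := 0) h').res _ _) le_rfl
      · rw [res_mul (b * u) b' w t, res_mul]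
        exact ((IsBlockWord.sync (r := 0) h).res _ _).mul_le (IsBlockWord.low (r := 0) h₀) le_rfl
    · refine ⟨t, by omega, ?_⟩
      rw [res_mul]
      exact (IsBlockWord.sync (r := 0) h).mul_le (IsBlockWord.low (r := 0) h') le_rfl
  · refine ⟨t, by omega, ?_⟩
    rw [res_mul]
    exact (IsBlockWord.low (r := 0) h).mul_le ((IsBlockWord.sync (r := 0) hb').res _ _) le_rfl

theorem IsBlockWord.res_two (hM : H.MergeTime M) (hK : ∀ j ≤ k, H.SyncTime j n K) {l : ℕ}
    (hl : l ≤ n) {g : treeAut X} (hg : H.IsBlockWord k 2 l g) (w : Stream' X) :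
    H.IsBlockWord k 1 l (_root_.res g w ((k + 1) * (K + M) + M)) := by
  obtain ⟨l₁, l₂, g₁, g₂, rfl, rfl, h₁, h₂⟩ := hg.split (s := 1) rfl
  rw [res_mul]
  rcases h₁.eq_of_one rfl with h₁' | ⟨a₁, a₂, a₃, u, b, v, rfl, rfl, hu, hb, hv⟩
  · exact ((low (r := 0) h₁').res _ _).mul_le (h₂.res _ _) le_rfl
  rcases h₂.eq_of_one rfl with h₂' | ⟨c₁, c₂, c₃, u', b', v', rfl, rfl, hu', hb', hv'⟩
  · exact (h₁.res _ _).mul_le ((low (r := 0) h₂').res _ _) le_rfl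
  -- Regroup so that the low words between the blocks become a single word `v * u'`; the outer words
  -- `u` and `v'` stay low.
  rw [← res_mul, show u * b * v * (u' * b' * v') = u * ((b * (v * u') * b') * v') by
    simp only [mul_assoc], show a₁ + a₂ + a₃ + (c₁ + c₂ + c₃) =
      a₁ + ((a₂ + (a₃ + c₁) + c₂) + c₃) by omega, res_mul u, res_mul _ v']
  exact ((low (r := 0) hu).res _ _).mul_le ((merge_two_blocks hM hK (by omega) hb
    (mul_mem_pow hv hu') hb' _).mul_le ((low (r := 0) hv').res _ _) le_rfl) le_rfl

theorem IsBlockWord.res_two_mul (hM : H.MergeTime M) (hK : ∀ j ≤ k, H.SyncTime j n K) {r l : ℕ}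
    (hl : l ≤ n) {g : treeAut X} (hg : H.IsBlockWord k (2 * r) l g) (w : Stream' X) :
    H.IsBlockWord k r l (_root_.res g w ((k + 1) * (K + M) + M)) := by
  induction r generalizing l g w with
  | zero => exact hg.res _ _
  | succ r ih =>
    obtain ⟨l₁, l₂, g₁, g₂, rfl, rfl, h₁, h₂⟩ := split_two (s := 2 * r) hg
    rw [res_mul]
    exact (h₁.res_two hM hK (by omega) _).mul_le (ih (by omega) h₂ _) (by omega)

theorem IsBlockWord.res_two_pow (hM : H.MergeTime M) (hK : ∀ j ≤ k, H.SyncTime j n K) {i l : ℕ}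
    (hl : l ≤ n) {g : treeAut X} (hg : H.IsBlockWord k (2 ^ i) l g) (w : Stream' X) :
    H.IsBlockWord k 1 l (_root_.res g w (i * ((k + 1) * (K + M) + M))) := by
  induction i generalizing g w with
  | zero => exact hg.res _ _
  | succ i ih =>
    rw [Nat.succ_mul, add_comm, res_add]
    exact ih (IsBlockWord.res_two_mul hM hK hl (by rwa [← pow_succ']) _) _

/-- The single block absorbs its low neighbour on the right, then the one on the left. If it drops
instead, everything is low and synchronizes within a further `K`. -/
theorem IsBlockWord.exists_isSync (hM : H.MergeTime M) (hK : ∀ j ≤ k, H.SyncTime j n K) {l : ℕ}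
    (hl : 1 ≤ l) (hln : l ≤ n) {g : treeAut X} (hg : H.IsBlockWord k 1 l g) (w : Stream' X) :
    ∃ t ≤ 2 * ((k + 1) * (K + M)) + K, H.IsSync (k + 1) l (_root_.res g w t) := by
  have low : ∀ {a : treeAut X} (z : Stream' X), a ∈ H.L k ^ l →
      ∃ t ≤ K, H.IsSync (k + 1) l (_root_.res a z t) := fun z ha =>
    let ⟨t, ht, h⟩ := hK k le_rfl l hl hln _ ha z
    ⟨t, ht, h.mono (Nat.le_succ k)⟩
  rcases hg.eq_of_one rfl with h | ⟨a₁, a₂, a₃, u, b, v, rfl, rfl, hu, hb, hv⟩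
  · obtain ⟨t, ht, h⟩ := low w h
    exact ⟨t, by omega, h⟩
  rw [add_assoc, mul_assoc] at *
  obtain ⟨t, ht, h | h⟩ := sync_or_low_mul_right hM hK le_rfl (by omega) hb hv w
  · obtain ⟨s, hs, h' | h'⟩ := sync_or_low_mul_left hM hK le_rfl (l' := a₁) (by omega) h
      (H.res_mem_pow hu ((b * v) • w) t) (shift t w)
    · refine ⟨t + s, by omega, ?_⟩
      rwa [res_add, res_mul]
    · obtain ⟨q, hq, h''⟩ := low (shift s (shift t w)) h'
      refine ⟨t + (s + q), by omega, ?_⟩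
      rwa [res_add, res_add, res_mul u]
  · obtain ⟨q, hq, h''⟩ := low (shift t w) (mul_mem_pow (H.res_mem_pow hu ((b * v) • w) t) h)
    refine ⟨t + q, by omega, ?_⟩
    rwa [res_add, res_mul u]

/-! ### Polylogarithmic synchronization time. -/

variable (H)

theorem isBlockWord_res_c {l : ℕ} {g : treeAut X} (hg : g ∈ H.L (k + 1) ^ l) (w : Stream' X) :
    H.IsBlockWord k l l (res g w H.c) := by
  induction l generalizing g w with
  | zero =>
    rw [pow_zero, Set.mem_one] at hg
    rw [hg, res_one]
    exact .low (by simp)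
  | succ l ih =>
    rw [pow_succ] at hg
    obtain ⟨a, ha, b, hb, rfl⟩ := Set.mem_mul.1 hg
    rw [res_mul]
    refine (ih ha _).mul ?_
    rcases H.res_L_succ k b hb w with h | ⟨p, hp, hbp, h⟩
    · exact .low (by rwa [pow_one])
    · exact .sync (r := 0) ⟨le_rfl, Or.inr ⟨p, hp, hbp, fun z t hz => by
        change _ ∈ H.L k ^ 1
        rw [pow_one]
        exact h z t hz⟩⟩

theorem res_c_mem_N_pow {l : ℕ} {g : treeAut X} (hg : g ∈ H.L 0 ^ l) (w : Stream' X) :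
    res g w H.c ∈ H.N ^ l := by
  induction l generalizing g w with
  | zero =>
    rw [pow_zero, Set.mem_one] at hg
    simp [hg]
  | succ l ih =>
    rw [pow_succ] at hg ⊢
    obtain ⟨a, ha, b, hb, rfl⟩ := Set.mem_mul.1 hg
    rw [res_mul]
    exact Set.mul_mem_mul (ih ha _) (H.res_L_zero b hb _)

theorem res_N_pow_two_mul {r : ℕ} {g : treeAut X} (hg : g ∈ H.N ^ (2 * r)) (w : Stream' X) :
    res g w H.d ∈ H.N ^ r := by
  induction r generalizing g w with
  | zero =>
    rw [mul_zero, pow_zero, Set.mem_one] at hg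
    simp [hg]
  | succ r ih =>
    rw [mul_add, pow_add] at hg
    obtain ⟨a, ha, b, hb, rfl⟩ := Set.mem_mul.1 hg
    rw [mul_one, pow_two] at hb
    obtain ⟨b₁, hb₁, b₂, hb₂, rfl⟩ := Set.mem_mul.1 hb
    rw [res_mul, pow_succ]
    exact Set.mul_mem_mul (ih ha _) (H.res_mul_mem_N _ hb₁ _ hb₂ _)

theorem res_N_pow_two_pow {i : ℕ} {g : treeAut X} (hg : g ∈ H.N ^ (2 ^ i)) (w : Stream' X) :
    res g w (i * H.d) ∈ H.N := by
  induction i generalizing g w with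
  | zero => simpa using hg
  | succ i ih =>
    rw [Nat.succ_mul, add_comm, res_add]
    exact ih (H.res_N_pow_two_mul (by rwa [← pow_succ']) _) _

theorem syncTime_zero (n : ℕ) : H.SyncTime 0 n (H.c + Nat.clog 2 n * H.d) := by
  intro l hl hln g hg w
  refine ⟨_, le_rfl, hl, Or.inl ?_⟩
  rw [res_add]
  refine H.res_N_pow_two_pow ?_ _
  exact Set.pow_subset_pow_right H.one_mem_N (hln.trans (Nat.le_pow_clog one_lt_two n))
    (H.res_c_mem_N_pow hg w)

/-- After `c` letters each factor is low or a block of its own; `Nat.clog 2 n` halvings leave at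
most one block, which then absorbs the rest. -/
theorem syncTime_succ (hM : H.MergeTime M) (hK : ∀ j ≤ k, H.SyncTime j n K) :
    H.SyncTime (k + 1) n (H.c + (Nat.clog 2 n * ((k + 1) * (K + M) + M) +
      (2 * ((k + 1) * (K + M)) + K))) := by
  intro l hl hln g hg w
  have h₁ := (H.isBlockWord_res_c hg w).mono (hln.trans (Nat.le_pow_clog one_lt_two n))
  have h₂ := h₁.res_two_pow hM hK hln (shift H.c w)
  obtain ⟨t, ht, h₃⟩ := h₂.exists_isSync hM hK hl hln (shift _ (shift H.c w))
  refine ⟨_, Nat.add_le_add_left (Nat.add_le_add_left ht _) _, ?_⟩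
  rwa [res_add, res_add]

/-- Words of `n` letters of level at most `k` get synchronized in time `O((log n)^(k+1))`. -/
theorem exists_syncTime (k : ℕ) :
    ∃ C, ∀ n, ∀ j ≤ k, H.SyncTime j n (C * (Nat.clog 2 n + 1) ^ (k + 1)) := by
  induction k with
  | zero =>
    refine ⟨H.c + H.d, fun n j hj => ?_⟩
    obtain rfl := Nat.le_zero.1 hj
    refine (H.syncTime_zero n).mono ?_
    rw [zero_add, pow_one]
    nlinarith [Nat.zero_le (H.c * Nat.clog 2 n)]
  | succ k ih =>
    obtain ⟨C, hC⟩ := ih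
    obtain ⟨M, hM⟩ := H.exists_mergeTime
    -- The first `C` serves levels `j ≤ k`; the other terms pay for the initial `c` letters, the
    -- halving rounds and the final absorption.
    refine ⟨C + H.c + (k + 1) * (C + M) + M + 2 * (k + 1) * (C + M) + C, fun n j hj => ?_⟩
    set q := Nat.clog 2 n + 1 with hq
    have hq1 : 1 ≤ q := by omega
    have h1 : 1 ≤ q ^ (k + 1) := Nat.one_le_pow _ _ hq1
    have h2 : q ^ (k + 1) ≤ q ^ (k + 1 + 1) := Nat.pow_le_pow_right hq1 (Nat.le_succ _)
    have h2' : q * q ^ (k + 1) = q ^ (k + 1 + 1) := (pow_succ' q (k + 1)).symm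
    rcases hj.lt_or_eq with hj | rfl
    · refine (hC n j (Nat.lt_succ_iff.1 hj)).mono ?_
      refine Nat.mul_le_mul ?_ h2
      omega
    · refine (H.syncTime_succ hM (hC n)).mono ?_
      set Q := q ^ (k + 1)
      set R := q ^ (k + 1 + 1)
      have e1 : C * Q + M ≤ (C + M) * Q := by
        rw [add_mul]; exact Nat.add_le_add_left (Nat.le_mul_of_pos_right M h1) _
      have e2 : (k + 1) * (C * Q + M) ≤ (k + 1) * (C + M) * Q := by
        rw [mul_assoc]; exact Nat.mul_le_mul_left _ e1
      calc _ ≤ H.c * R + (q * ((k + 1) * (C + M) * Q + M * Q) +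
            (2 * ((k + 1) * (C + M) * R) + C * R)) := by
            refine Nat.add_le_add (Nat.le_mul_of_pos_right _ (h1.trans h2))
              (Nat.add_le_add (Nat.mul_le_mul (by omega) (Nat.add_le_add e2
                (Nat.le_mul_of_pos_right M h1))) (Nat.add_le_add (Nat.mul_le_mul_left 2
                  (e2.trans (Nat.mul_le_mul_left _ h2))) (Nat.mul_le_mul_left C h2)))
        _ = (H.c + (k + 1) * (C + M) + M + 2 * (k + 1) * (C + M) + C) * R := by
            rw [← h2']; ring
        _ ≤ _ := Nat.mul_le_mul_right _ (by omega)

end LetterHierarchy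

/-! ### Counting the images of an infinite word. -/

/-- Every infinite word has at most `F` images under the transformations in `G`. -/
def OrbitBound {X : Type*} (G : Set (treeAut X)) (F : ℕ) : Prop :=
  ∀ w : Stream' X, ∃ s : Finset (Stream' X), s.card ≤ F ∧ ∀ g ∈ G, g • w ∈ s

theorem exists_finset_prefixes (X : Type*) [Fintype X] [Nonempty X] (K : ℕ) :
    ∃ U : Finset (Stream' X), U.card ≤ Fintype.card X ^ K ∧ ∀ w, ∃ u ∈ U, AgreeTo K u w := by
  classical
  obtain ⟨x⟩ := ‹Nonempty X›
  let ext : (Fin K → X) → Stream' X := fun f i => if h : i < K then f ⟨i, h⟩ else x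
  refine ⟨Finset.univ.image ext, Finset.card_image_le.trans (by simp), fun w => ?_⟩
  exact ⟨_, Finset.mem_image_of_mem _ (Finset.mem_univ fun i : Fin K => w (i : ℕ)), fun i hi => dif_pos hi⟩

namespace LetterHierarchy

variable {X : Type*} {H : LetterHierarchy X}

/-- The factors count the synchronization time `t ≤ K`, the output prefix, and the possible tails,
where `F` bounds the images after departure. -/
theorem SyncTime.orbitBound [Fintype X] [Nonempty X] {k n K F : ℕ} (hn : 1 ≤ n)
    (hK : H.SyncTime k n K) (hF : OrbitBound (H.lower k n) F) :
    OrbitBound (H.L k ^ n) ((K + 1) * (Fintype.card X ^ K * (H.N.ncard + H.P.ncard +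
      H.P.ncard * (H.P.ncard * (Fintype.card X * F))))) := by
  classical
  intro w
  obtain ⟨U, hUc, hU⟩ := exists_finset_prefixes X K
  choose s hsc hs using hF
  have hNf := H.finite_N
  have hPf := H.finite_P
  set N := hNf.toFinset with hN
  set P := hPf.toFinset with hP
  -- First position where `y` departs from `p`. The value `0` for `y = p` is harmless: it only adds
  -- candidates.
  let dep : Stream' X → Stream' X → ℕ := fun y p => if h : ∃ i, y i ≠ p i then Nat.find h else 0
  have hdep : ∀ y p : Stream' X, y ≠ p → AgreeTo (dep y p) y p ∧ y (dep y p) ≠ p (dep y p) := by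
    intro y p hyp
    have h : ∃ i, y i ≠ p i := by
      by_contra! h
      exact hyp (funext h)
    simp only [dep, dif_pos h]
    exact ⟨fun i hi => not_not.1 (Nat.find_min h hi), Nat.find_spec h⟩
  -- Candidates for `a • y` with `a` synchronized: a nucleus image, a word of `P` when `y = p`, or a
  -- prefix of `q = a • p` up to the departure, one free letter, and an image of the remaining input
  -- under a lower-level word.
  let tails : Stream' X → Finset (Stream' X) := fun y =>
    N.image (fun g => g • y) ∪ P ∪ P.biUnion fun p => P.biUnion fun q =>
      (Finset.univ : Finset X).biUnion fun x =>
        (s (shift (dep y p + 1) y)).image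
          (splice (dep y p + 1) (splice (dep y p) q fun _ => x))
  have htails : ∀ y, (tails y).card ≤ H.N.ncard + H.P.ncard +
      H.P.ncard * (H.P.ncard * (Fintype.card X * F)) := by
    intro y
    rw [Set.ncard_eq_toFinset_card _ hNf, Set.ncard_eq_toFinset_card _ hPf]
    refine (Finset.card_union_le _ _).trans (Nat.add_le_add ((Finset.card_union_le _ _).trans
      (Nat.add_le_add_right Finset.card_image_le _)) ?_)
    refine Finset.card_biUnion_le_card_mul _ _ _ fun p _ =>
      Finset.card_biUnion_le_card_mul _ _ _ fun q _ =>
      Finset.card_biUnion_le_card_mul _ _ _ fun x _ => Finset.card_image_le.trans (hsc _)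
  refine ⟨(Finset.range (K + 1)).biUnion fun t => U.biUnion fun u =>
    (tails (shift t w)).image (splice t u), ?_, ?_⟩
  · calc _ ≤ (Finset.range (K + 1)).card * _ := Finset.card_biUnion_le_card_mul _ _ _ fun t _ =>
          Finset.card_biUnion_le_card_mul _ _ _ fun u _ => Finset.card_image_le.trans (htails _)
      _ ≤ _ := by
          rw [Finset.card_range]
          exact Nat.mul_le_mul_left _ (Nat.mul_le_mul_right _ hUc)
  · intro g hg
    obtain ⟨t, ht, -, hsync⟩ := hK n hn le_rfl g hg w
    obtain ⟨u, hu, hug⟩ := hU (g • w)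
    simp only [Finset.mem_biUnion, Finset.mem_range, Finset.mem_image]
    refine ⟨t, by omega, u, hu, res g w t • shift t w, ?_, ?_⟩
    · simp only [tails, Finset.mem_union, Finset.mem_biUnion, Finset.mem_image, hN, hP,
        Set.Finite.mem_toFinset, Finset.mem_univ, true_and]
      set y := shift t w
      set a := res g w t
      rcases hsync with h | ⟨p, hp, hap, hd⟩
      · exact Or.inl (Or.inl ⟨a, h, rfl⟩)
      · by_cases hyp : y = p
        · rw [hyp]
          exact Or.inl (Or.inr hap)
        · obtain ⟨h₁, h₂⟩ := hdep y p hyp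
          refine Or.inr ⟨p, hp, a • p, hap, (a • y) (dep y p), _,
            hs (shift (dep y p + 1) y) _ (hd y (dep y p + 1) fun h => h₂ (h _ (Nat.lt_succ_self _))),
            ?_⟩
          rw [smul_eq_splice a y (dep y p + 1)]
          refine splice_congr (fun i hi => ?_) _
          rcases (Nat.lt_succ_iff_lt_or_eq.1 hi) with hi | rfl
          · exact (splice_apply_of_lt (a • p) _ hi).trans (((agreeTo_smul a).2 h₁).symm i hi)
          · simp only [splice, lt_irrefl, if_false]
            rw [← shift_smul]
            simp [shift]
    · conv_rhs => rw [smul_eq_splice g w t]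
      exact splice_congr (hug.mono ht) _

variable (H)

/-- The words of `n` letters of level at most `k` map an infinite word to at most
`|X| ^ O((log n)^(k+1))` infinite words. -/
theorem exists_orbitBound [Fintype X] [Nontrivial X] (k : ℕ) : ∃ C, ∀ n, 1 ≤ n →
    OrbitBound (H.lower k n) (Fintype.card X ^ (C * (Nat.clog 2 n + 1) ^ k)) := by
  induction k with
  | zero => exact ⟨0, fun n _ w => ⟨∅, by simp, fun g hg => hg.elim⟩⟩
  | succ k ih =>
    obtain ⟨C, hC⟩ := ih
    obtain ⟨C', hC'⟩ := H.exists_syncTime k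
    set κ := H.N.ncard + H.P.ncard + H.P.ncard * (H.P.ncard * Fintype.card X) with hκ
    -- One `C'` is for the choice of time (`K + 1 ≤ |X| ^ K`) and one for the output prefix; `κ` and
    -- `C` are for the tails.
    refine ⟨C' + C' + κ + C, fun n hn w => ?_⟩
    obtain ⟨s, hs, h⟩ := SyncTime.orbitBound hn (hC' n k le_rfl) (hC n hn) w
    refine ⟨s, hs.trans ?_, h⟩
    set q := Nat.clog 2 n + 1 with hq
    have hq1 : 1 ≤ q := by omega
    have h1 : 1 ≤ q ^ (k + 1) := Nat.one_le_pow _ _ hq1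
    have h2 : q ^ k ≤ q ^ (k + 1) := Nat.pow_le_pow_right hq1 (Nat.le_succ _)
    have hX : 2 ≤ Fintype.card X := Fintype.one_lt_card
    set x := Fintype.card X
    set K := C' * q ^ (k + 1)
    set F := x ^ (C * q ^ k)
    have hF : 1 ≤ F := Nat.one_le_pow _ _ (by omega)
    have pow_bound : ∀ i, i + 1 ≤ x ^ i := fun i =>
      (Nat.lt_two_pow_self : i < 2 ^ i).trans_le (Nat.pow_le_pow_left hX i)
    have hκF : H.N.ncard + H.P.ncard + H.P.ncard * (H.P.ncard * (x * F)) ≤ κ * F := by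
      have : κ * F = (H.N.ncard + H.P.ncard) * F + H.P.ncard * (H.P.ncard * (x * F)) := by
        rw [hκ]; ring
      rw [this]
      exact Nat.add_le_add_right (Nat.le_mul_of_pos_right _ hF) _
    calc _ ≤ x ^ K * (x ^ K * (x ^ κ * x ^ (C * q ^ k))) := by
          refine Nat.mul_le_mul (pow_bound K) (Nat.mul_le_mul_left _ (hκF.trans ?_))
          exact Nat.mul_le_mul_right _ ((Nat.le_succ _).trans (pow_bound κ))
      _ = x ^ (K + K + κ + C * q ^ k) := by ring
      _ ≤ _ := by
          refine Nat.pow_le_pow_right (by omega) ?_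
          have e1 : κ ≤ κ * q ^ (k + 1) := Nat.le_mul_of_pos_right _ h1
          have e2 : C * q ^ k ≤ C * q ^ (k + 1) := Nat.mul_le_mul_left _ h2
          calc _ ≤ K + K + κ * q ^ (k + 1) + C * q ^ (k + 1) := by omega
            _ = _ := by simp only [K]; ring

end LetterHierarchy

/-! ### States as tree automorphisms; cycles and levels. -/

namespace InvAutomaton

variable {S X : Type*} (A : InvAutomaton S X)

theorem stateAt_succ (s : S) (w : Stream' X) (n : ℕ) :
    A.stateAt s w (n + 1) = A.trans (A.stateAt s w n) (w n) := rfl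

theorem act_apply (s : S) (w : Stream' X) (n : ℕ) :
    A.act s w n = A.out (A.stateAt s w n) (w n) := rfl

theorem stateAt_congr (s : S) {w z : Stream' X} {n : ℕ} (h : AgreeTo n w z) :
    A.stateAt s w n = A.stateAt s z n := by
  induction n with
  | zero => rfl
  | succ n ih =>
    rw [stateAt_succ, stateAt_succ, ih (h.mono (Nat.le_succ n)), h n (Nat.lt_succ_self n)]

theorem stateAt_add (s : S) (w : Stream' X) (t n : ℕ) :
    A.stateAt s w (t + n) = A.stateAt (A.stateAt s w t) (shift t w) n := by
  induction n with
  | zero => rfl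
  | succ n ih => rw [← add_assoc, stateAt_succ, stateAt_succ, ih]; rfl

theorem perm_mem_treeAut (s : S) : A.perm s ∈ treeAut X := by
  intro n w z
  change _ ↔ AgreeTo n (A.act s w) (A.act s z)
  induction n with
  | zero => simp [AgreeTo]
  | succ n ih =>
    have key : ∀ y y' : Stream' X, AgreeTo (n + 1) y y' ↔ AgreeTo n y y' ∧ y n = y' n := by
      intro y y'
      refine ⟨fun h => ⟨h.mono (Nat.le_succ n), h n (Nat.lt_succ_self n)⟩, fun ⟨h, h'⟩ i hi => ?_⟩
      rcases Nat.lt_succ_iff_lt_or_eq.1 hi with hi | rfl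
      exacts [h i hi, h']
    rw [key, key, ← ih]
    refine and_congr_right fun h => ?_
    rw [act_apply, act_apply, A.stateAt_congr s h, EmbeddingLike.apply_eq_iff_eq]

/-- The transformation defined by the state `s` as a tree automorphism. -/
def aut (s : S) : treeAut X := ⟨A.perm s, A.perm_mem_treeAut s⟩

theorem res_aut (s : S) (w : Stream' X) (t : ℕ) : res (A.aut s) w t = A.aut (A.stateAt s w t) := by
  refine treeAut_ext fun z => funext fun i => ?_
  change A.act s (splice t w z) (t + i) = A.act (A.stateAt s w t) z i
  rw [act_apply, act_apply, stateAt_add, A.stateAt_congr s (agreeTo_splice t w z),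
    splice_apply_add, shift_splice]

theorem res_aut_inv (s : S) (w : Stream' X) (t : ℕ) :
    res (A.aut s)⁻¹ w t = (A.aut (A.stateAt s ((A.aut s)⁻¹ • w) t))⁻¹ := by
  rw [res_inv, res_aut]

theorem restr_append (s : S) (u v : List X) : A.restr s (u ++ v) = A.restr (A.restr s u) v := by
  induction u generalizing s with
  | nil => rfl
  | cons x u ih => exact ih _

theorem exists_restr_eq_stateAt (s : S) (w : Stream' X) (n : ℕ) :
    ∃ v, A.restr s v = A.stateAt s w n := by
  induction n with
  | zero => exact ⟨[], rfl⟩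
  | succ n ih =>
    obtain ⟨v, hv⟩ := ih
    exact ⟨v ++ [w n], by rw [restr_append, hv]; rfl⟩

variable {A}

theorem IsSubautomaton.restr_mem {B : Set S} (hB : A.IsSubautomaton B) {s : S} (hs : s ∈ B)
    (v : List X) : A.restr s v ∈ B := by
  induction v generalizing s with
  | nil => exact hs
  | cons x v ih => exact ih (hB s hs x)

theorem IsSubautomaton.stateAt_mem {B : Set S} (hB : A.IsSubautomaton B) {s : S} (hs : s ∈ B)
    (w : Stream' X) (n : ℕ) : A.stateAt s w n ∈ B := by
  obtain ⟨v, hv⟩ := A.exists_restr_eq_stateAt s w n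
  exact hv ▸ hB.restr_mem hs v

theorem IsCycle.eq_of_mem {E : Set (S × X)} (hE : A.IsCycle E) {s : S} {x y : X}
    (hx : (s, x) ∈ E) (hy : (s, y) ∈ E) : x = y := by
  obtain ⟨k, σ, l, hσ, -, rfl⟩ := hE
  obtain ⟨i, hi⟩ := hx
  obtain ⟨j, hj⟩ := hy
  simp only [Prod.mk.injEq] at hi hj
  obtain rfl : i = j := hσ (hi.1.trans hj.1.symm)
  exact hi.2.symm.trans hj.2

theorem IsCycle.trans_mem {E : Set (S × X)} (hE : A.IsCycle E) {s : S} {x : X}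
    (hx : (s, x) ∈ E) : A.trans s x ∈ states E := by
  obtain ⟨k, σ, l, hσ, ht, rfl⟩ := hE
  obtain ⟨i, hi⟩ := hx
  simp only [Prod.mk.injEq] at hi
  rw [← hi.1, ← hi.2, ht]
  exact ⟨_, ⟨i + 1, rfl⟩, rfl⟩

theorem IsCycle.exists_restr_eq {E : Set (S × X)} (hE : A.IsCycle E) {s q : S}
    (hs : s ∈ states E) (hq : q ∈ states E) : ∃ v, A.restr s v = q := by
  obtain ⟨k, σ, l, hσ, ht, rfl⟩ := hE
  obtain ⟨_, ⟨i, rfl⟩, rfl⟩ := hs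
  obtain ⟨_, ⟨j, rfl⟩, rfl⟩ := hq
  have key : ∀ n : ℕ, ∃ v, A.restr (σ i) v = σ (i + (Fin.ofNat (k + 1) n)) := by
    intro n
    induction n with
    | zero => exact ⟨[], by simp [restr]⟩
    | succ n ih =>
      obtain ⟨v, hv⟩ := ih
      refine ⟨v ++ [l (i + Fin.ofNat (k + 1) n)], ?_⟩
      rw [restr_append, hv]
      change A.trans _ _ = _
      rw [ht, add_assoc]
      congr 2
      ext
      simp [Fin.val_add]
  obtain ⟨v, hv⟩ := key (j - i : Fin (k + 1)).val
  refine ⟨v, ?_⟩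
  simpa using hv

/-- A shortest return path is simple, since a repeated state could be cut out. It avoids `B`, since
`B` cannot be left and the path ends at `s ∉ B`. -/
theorem exists_isCycleOutside {B : Set S} (hB : A.IsSubautomaton B) {s : S} (hs : s ∉ B) {y : X}
    {v : List X} (hv : A.restr (A.trans s y) v = s) : ∃ E, A.IsCycleOutside B E ∧ (s, y) ∈ E := by
  classical
  have hex : ∃ n, ∃ v : List X, v.length = n ∧ A.restr (A.trans s y) v = s := ⟨_, v, rfl, hv⟩
  obtain ⟨u, hu, hus⟩ := Nat.find_spec hex
  have hmin : ∀ z : List X, A.restr (A.trans s y) z = s → u.length ≤ z.length := fun z hz =>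
    hu ▸ Nat.find_min' hex ⟨z, rfl, hz⟩
  set σ : Fin (u.length + 1) → S := fun i => A.restr s ((y :: u).take i) with hσ
  have hlast : A.restr s (y :: u) = s := hus
  have inj : ∀ i j : ℕ, i < j → j ≤ u.length →
      A.restr s ((y :: u).take i) ≠ A.restr s ((y :: u).take j) := by
    intro i j hij hj h
    have h' : A.restr s ((y :: u).take i ++ (y :: u).drop j) = s := by
      rw [restr_append, h, ← restr_append, List.take_append_drop, hlast]
    obtain ⟨j, rfl⟩ : ∃ j', j = j' + 1 := ⟨j - 1, by omega⟩
    cases i with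
    | zero =>
      have := hmin (u.take j) (by simpa [restr] using h.symm)
      simp at this
      omega
    | succ i =>
      have := hmin (u.take i ++ u.drop j) (by simpa [restr] using h')
      simp at this
      omega
  refine ⟨Set.range fun i => (σ i, (y :: u).get i), ⟨⟨u.length, σ, (y :: u).get, ?_, ?_, rfl⟩, ?_⟩,
    ⟨0, rfl⟩⟩
  · intro i j h
    rcases lt_trichotomy i.val j.val with hij | hij | hij
    · exact (inj _ _ hij (Nat.lt_succ_iff.1 j.2) h).elim
    · exact Fin.ext hij
    · exact (inj _ _ hij (Nat.lt_succ_iff.1 i.2) h.symm).elim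
  · intro i
    have h1 : A.trans (σ i) ((y :: u).get i) = A.restr s ((y :: u).take (i + 1)) := by
      have : (y :: u).take (i.val + 1) = (y :: u).take i ++ [(y :: u).get i] := by
        rw [List.take_add_one, List.getElem?_eq_getElem i.2]
        rfl
      rw [this, restr_append]
      rfl
    rw [h1]
    rcases (Nat.lt_succ_iff.1 i.2).lt_or_eq with hi | hi
    · have : (i + 1).val = i.val + 1 := by
        rw [Fin.val_add_one_of_lt]
        exact Fin.lt_def.2 (by simpa using hi)
      simp only [hσ, this]
    · have : i = Fin.last _ := Fin.ext hi
      rw [this, Fin.last_add_one]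
      simpa [hσ, restr] using hlast
  · rintro _ ⟨_, ⟨i, rfl⟩, rfl⟩ hi
    refine hs ?_
    have := hB.restr_mem hi ((y :: u).drop i)
    rwa [← restr_append, List.take_append_drop, hlast] at this

variable (A)

/-- Every directed path starting at `s` passes through at most `k` cycles outside `B`. -/
def LevelLE (B : Set S) (k : ℕ) (s : S) : Prop :=
  ∀ (𝓔 : Finset (Set (S × X))) (v : List X), (∀ E ∈ 𝓔, A.IsCycleOutside B E) →
    (∀ E ∈ 𝓔, ∃ u, u <+: v ∧ A.restr s u ∈ states E) → 𝓔.card ≤ k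

variable {A} {B : Set S}

theorem IsMaxConnectedCycles.levelLE {m : ℕ} (hm : A.IsMaxConnectedCycles B m) (s : S) :
    A.LevelLE B m s := fun 𝓔 v h h' => hm.2 ⟨𝓔, h, ⟨s, v, h'⟩, rfl⟩

theorem LevelLE.mono {k l : ℕ} {s : S} (h : A.LevelLE B k s) (hkl : k ≤ l) : A.LevelLE B l s :=
  fun 𝓔 v h₁ h₂ => (h 𝓔 v h₁ h₂).trans hkl

theorem LevelLE.trans {k : ℕ} {s : S} (h : A.LevelLE B k s) (x : X) :
    A.LevelLE B k (A.trans s x) := by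
  intro 𝓔 v h₁ h₂
  refine h 𝓔 (x :: v) h₁ fun E hE => ?_
  obtain ⟨u, hu, hu'⟩ := h₂ E hE
  exact ⟨x :: u, List.cons_prefix_cons.2 ⟨rfl, hu⟩, hu'⟩

theorem LevelLE.stateAt {k : ℕ} {s : S} (h : A.LevelLE B k s) (w : Stream' X) (n : ℕ) :
    A.LevelLE B k (A.stateAt s w n) := by
  induction n with
  | zero => exact h
  | succ n ih => exact ih.trans _

theorem LevelLE.notMem_states {s : S} (h : A.LevelLE B 0 s) {E : Set (S × X)}
    (hE : A.IsCycleOutside B E) : s ∉ states E := by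
  intro hs
  have := h {E} [] (by simpa using hE) fun F hF =>
    ⟨[], List.nil_prefix, Finset.mem_singleton.1 hF ▸ hs⟩
  simp at this

/-- No path after the exit by `y` meets `E` again: it could be continued to `s`, giving a second
cycle through `s` starting with `y`, against disjointness. So `E` can be added to any family of
cycles met after the exit. -/
theorem LevelLE.trans_of_ne (hB : A.IsSubautomaton B) (hdisj : A.DisjointCyclesOutside B) {k : ℕ}
    {s : S} (h : A.LevelLE B (k + 1) s) {E : Set (S × X)} (hE : A.IsCycleOutside B E) {x y : X}
    (hx : (s, x) ∈ E) (hxy : y ≠ x) : A.LevelLE B k (A.trans s y) := by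
  classical
  intro 𝓔 v h₁ h₂
  have hs : s ∈ states E := ⟨_, hx, rfl⟩
  have hE𝓔 : E ∉ 𝓔 := by
    intro hmem
    obtain ⟨u, -, hu⟩ := h₂ E hmem
    obtain ⟨u', hu'⟩ := hE.1.exists_restr_eq hu hs
    rw [← restr_append] at hu'
    obtain ⟨F, hF, hy⟩ := exists_isCycleOutside hB (hE.2 hs) hu'
    have hEF : E ≠ F := by
      rintro rfl
      exact hxy (hE.1.eq_of_mem hy hx)
    exact Set.disjoint_left.1 (hdisj E F hE hF hEF) hs ⟨_, hy, rfl⟩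
  have := h (insert E 𝓔) (y :: v) ?_ ?_
  · rw [Finset.card_insert_of_notMem hE𝓔] at this
    omega
  · intro F hF
    rcases Finset.mem_insert.1 hF with rfl | hF
    exacts [hE, h₁ F hF]
  · intro F hF
    rcases Finset.mem_insert.1 hF with rfl | hF
    · exact ⟨[], List.nil_prefix, hs⟩
    · obtain ⟨u, hu, hu'⟩ := h₂ F hF
      exact ⟨y :: u, List.cons_prefix_cons.2 ⟨rfl, hu⟩, hu'⟩

theorem stateAt_mem_states_or_levelLE (hB : A.IsSubautomaton B) (hdisj : A.DisjointCyclesOutside B)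
    {k : ℕ} {s : S} (h : A.LevelLE B (k + 1) s) {E : Set (S × X)} (hE : A.IsCycleOutside B E)
    (hs : s ∈ states E) (w : Stream' X) (n : ℕ) :
    A.stateAt s w n ∈ states E ∨ A.LevelLE B k (A.stateAt s w n) := by
  induction n with
  | zero => exact Or.inl hs
  | succ n ih =>
    rcases ih with ih | ih
    · obtain ⟨⟨q, x⟩, hx, hq⟩ := ih
      change q = _ at hq
      subst hq
      rw [stateAt_succ]
      by_cases hw : w n = x
      · rw [hw]
        exact Or.inl (hE.1.trans_mem hx)
      · exact Or.inr ((h.stateAt w n).trans_of_ne hB hdisj hE hx hw)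
    · exact Or.inr (ih.trans _)

/-- Within as many steps as there are states, every path enters `B` or meets a cycle outside
`B`. -/
theorem stateAt_card_mem_or_exists_cycle [Finite S] (hB : A.IsSubautomaton B) (s : S)
    (w : Stream' X) : A.stateAt s w (Nat.card S) ∈ B ∨
      ∃ i ≤ Nat.card S, ∃ E, A.IsCycleOutside B E ∧ A.stateAt s w i ∈ states E := by
  have := Fintype.ofFinite S
  -- Pigeonhole: a repeated state lies in `B` or on a cycle outside `B`.
  obtain ⟨i, j, hij, h⟩ : ∃ i j : Fin (Nat.card S + 1), i < j ∧
      A.stateAt s w i = A.stateAt s w j := by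
    obtain ⟨i, j, hij, h⟩ := Fintype.exists_ne_map_eq_of_card_lt
      (fun i : Fin (Nat.card S + 1) => A.stateAt s w i) (by simp [Nat.card_eq_fintype_card])
    rcases lt_or_gt_of_ne hij with hij | hij
    exacts [⟨i, j, hij, h⟩, ⟨j, i, hij, h.symm⟩]
  have hi : i.val ≤ Nat.card S := Nat.lt_succ_iff.1 i.2
  by_cases hs : A.stateAt s w i ∈ B
  · left
    rw [← Nat.add_sub_cancel' hi, stateAt_add]
    exact hB.stateAt_mem hs _ _
  · right
    obtain ⟨n, hn⟩ : ∃ n, j.val = i.val + 1 + n := ⟨j.val - i.val - 1, by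
      have := Fin.lt_def.1 hij; omega⟩
    rw [hn, stateAt_add] at h
    obtain ⟨v, hv⟩ := A.exists_restr_eq_stateAt (A.stateAt s w (i.val + 1)) (shift (i.val + 1) w) n
    rw [← h, stateAt_succ] at hv
    obtain ⟨E, hE, hmem⟩ := exists_isCycleOutside hB hs hv
    exact ⟨i, hi, E, hE, _, hmem, rfl⟩

end InvAutomaton

/-- The length of the output prefix is fixed, so deleting it determines `h`; this translates the
contraction hypothesis into statements about `res`. -/
theorem isRestriction_unique {X : Type*} [Nonempty X] (g : treeAut X) (w : Stream' X) (t : ℕ)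
    {h : Equiv.Perm (Stream' X)}
    (hr : IsRestriction g.1 (List.ofFn fun i : Fin t => w (i : ℕ)) h) : h = (res g w t).1 := by
  obtain ⟨u, hu, H⟩ := hr
  rw [List.length_ofFn] at hu
  have hget : ∀ (a : List X) (z : Stream' X) (i : ℕ),
      (a ++ₛ z) i = if hi : i < a.length then a[i] else z (i - a.length) := by
    intro a z i
    split_ifs with hi
    · exact Stream'.get_append_left i a z hi
    · obtain ⟨j, rfl⟩ : ∃ j, i = a.length + j := ⟨i - a.length, by omega⟩
      rw [Nat.add_sub_cancel_left]
      exact Stream'.get_append_right j a z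
  refine Equiv.ext fun z => ?_
  change h z = shift t (g.1 (splice t w z))
  have e : splice t w z = (List.ofFn fun i : Fin t => w (i : ℕ)) ++ₛ z := by
    funext i
    rw [hget]
    simp [splice]
  rw [e, H]
  funext i
  change _ = (u ++ₛ h z) (t + i)
  rw [hget, dif_neg (by omega), hu, Nat.add_sub_cancel_left]

/-! ### The nucleus of the contracting subgroup. -/

namespace InvAutomaton

variable {S X : Type*} (A : InvAutomaton S X) {B : Set S}

/-- The group generated by the states in `B` as a group of tree automorphisms. -/
def autGroup (B : Set S) : Subgroup (treeAut X) := Subgroup.closure (A.aut '' B)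

theorem map_autGroup (B : Set S) : (A.autGroup B).map (treeAut X).subtype = A.groupOf B := by
  rw [autGroup, MonoidHom.map_closure, groupOf, Set.image_image]
  rfl

theorem coe_mem_groupOf {g : treeAut X} : g.1 ∈ A.groupOf B ↔ g ∈ A.autGroup B := by
  rw [← map_autGroup]
  constructor
  · rintro ⟨h, hh, e⟩
    rwa [← Subtype.ext (a1 := h) (a2 := g) e]
  · exact fun h => ⟨g, h, rfl⟩

variable {A}

theorem IsSubautomaton.res_mem_autGroup (hB : A.IsSubautomaton B) {g : treeAut X}
    (hg : g ∈ A.autGroup B) (w : Stream' X) (t : ℕ) : res g w t ∈ A.autGroup B := by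
  induction hg using Subgroup.closure_induction generalizing w with
  | mem g hg =>
    obtain ⟨s, hs, rfl⟩ := hg
    rw [res_aut]
    exact Subgroup.subset_closure ⟨_, hB.stateAt_mem hs w t, rfl⟩
  | one => rw [res_one]; exact one_mem _
  | mul g h _ _ ih ih' => rw [res_mul]; exact mul_mem (ih _) (ih' _)
  | inv g _ ih => rw [res_inv]; exact inv_mem (ih _)

theorem finite_res_of_lt [Finite X] [Nonempty X] (g : treeAut X) (n : ℕ) :
    {h | ∃ w, ∃ t < n, h = res g w t}.Finite := by
  have := Fintype.ofFinite X
  obtain ⟨U, -, hU⟩ := exists_finset_prefixes X n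
  refine ((U.finite_toSet.prod (Set.finite_lt_nat n)).image fun x => res g x.1 x.2).subset ?_
  rintro _ ⟨w, t, ht, rfl⟩
  obtain ⟨u, hu, huw⟩ := hU w
  exact ⟨(u, t), ⟨hu, ht⟩, res_congr g (huw.mono ht.le)⟩

/-- A contracting group generated by a finite subautomaton has a finite symmetric nucleus that
contains the generators and is closed under restrictions. -/
theorem exists_nucleus [Finite S] [Finite X] [Nonempty X] (hB : A.IsSubautomaton B)
    (hcontr : IsContracting (A.groupOf B)) : ∃ (N : Set (treeAut X)) (d : ℕ), N.Finite ∧ 1 ∈ N ∧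
      (∀ g ∈ N, g⁻¹ ∈ N) ∧ (∀ g ∈ N, ∀ w t, res g w t ∈ N) ∧
      (∀ g ∈ N, ∀ h ∈ N, ∀ w, res (g * h) w d ∈ N) ∧ ∀ s ∈ B, A.aut s ∈ N := by
  obtain ⟨N₀, hN₀f, hN₀, hc⟩ := hcontr
  set N₁ : Set (treeAut X) := Subtype.val ⁻¹' N₀
  have hN₁f : N₁.Finite := hN₀f.preimage Subtype.val_injective.injOn
  have hN₁G : ∀ g ∈ N₁, g ∈ A.autGroup B := fun g hg => A.coe_mem_groupOf.1 (hN₀ hg)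
  have hc₁ : ∀ g ∈ A.autGroup B, ∃ n, ∀ w t, n ≤ t → res g w t ∈ N₁ := by
    intro g hg
    obtain ⟨n, hn⟩ := hc g.1 (A.coe_mem_groupOf.2 hg)
    refine ⟨n, fun w t ht => ?_⟩
    obtain ⟨h, hh, hr⟩ := hn (List.ofFn fun i : Fin t => w (i : ℕ)) (by simpa using ht)
    rwa [isRestriction_unique g w t hr] at hh
  set Y₀ : Set (treeAut X) := {1} ∪ A.aut '' B ∪ N₁ with hY₀
  set Y : Set (treeAut X) := Y₀ ∪ Y₀⁻¹ with hY
  have hY₀f : Y₀.Finite := ((Set.finite_singleton 1).union ((Set.toFinite B).image _)).union hN₁f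
  have hYf : Y.Finite := hY₀f.union hY₀f.inv
  have hY₀G : ∀ g ∈ Y₀, g ∈ A.autGroup B := by
    rintro g ((rfl | hg) | hg)
    exacts [one_mem _, Subgroup.subset_closure hg, hN₁G g hg]
  have hYG : ∀ g ∈ Y, g ∈ A.autGroup B := by
    rintro g (hg | hg)
    exacts [hY₀G g hg, inv_mem_iff.1 (hY₀G _ hg)]
  have hYinv : ∀ g ∈ Y, g⁻¹ ∈ Y := by
    rintro g (hg | hg)
    exacts [Or.inr (by simpa using hg), Or.inl hg]
  -- Closing under all restrictions keeps the set finite: long restrictions lie in `N₁`, and there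
  -- are finitely many short ones.
  set N : Set (treeAut X) := {h | ∃ g ∈ Y, ∃ w t, h = res g w t}
  have hYN : Y ⊆ N := fun g hg => ⟨g, hg, Stream'.const (Classical.arbitrary X), 0, by simp⟩
  have hNf : N.Finite := by
    have : ∀ g ∈ Y, {h | ∃ w t, h = res g w t}.Finite := by
      intro g hg
      obtain ⟨n, hn⟩ := hc₁ g (hYG g hg)
      refine (hN₁f.union (finite_res_of_lt g n)).subset ?_
      rintro _ ⟨w, t, rfl⟩
      rcases le_or_gt n t with ht | ht
      exacts [Or.inl (hn w t ht), Or.inr ⟨w, t, ht, rfl⟩]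
    refine (hYf.biUnion this).subset ?_
    rintro h ⟨g, hg, hh⟩
    exact Set.mem_biUnion hg hh
  have hNG : ∀ g ∈ N, g ∈ A.autGroup B := by
    rintro _ ⟨g, hg, w, t, rfl⟩
    exact hB.res_mem_autGroup (hYG g hg) w t
  have hN₁N : N₁ ⊆ N := fun g hg => hYN (Or.inl (Or.inr hg))
  have hd : ∃ d, ∀ g ∈ N, ∀ h ∈ N, ∀ w, res (g * h) w d ∈ N := by
    have : ∀ g ∈ N, ∀ h ∈ N, ∀ᶠ d in Filter.atTop, ∀ w, res (g * h) w d ∈ N := by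
      intro g hg h hh
      obtain ⟨n, hn⟩ := hc₁ (g * h) (mul_mem (hNG g hg) (hNG h hh))
      filter_upwards [Filter.eventually_ge_atTop n] with d hd w using hN₁N (hn w d hd)
    exact ((Filter.eventually_all_finite hNf).2 fun g hg =>
      (Filter.eventually_all_finite hNf).2 fun h hh => this g hg h hh).exists
  obtain ⟨d, hd⟩ := hd
  refine ⟨N, d, hNf, hYN (Or.inl (Or.inl (Or.inl rfl))), ?_, ?_, hd,
    fun s hs => hYN (Or.inl (Or.inl (Or.inr ⟨s, hs, rfl⟩)))⟩
  · rintro _ ⟨g, hg, w, t, rfl⟩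
    exact ⟨g⁻¹, hYinv g hg, g • w, t, by rw [res_inv, inv_smul_smul]⟩
  · rintro _ ⟨g, hg, w, t, rfl⟩ z s
    exact ⟨g, hg, splice t w z, t + s, by
      rw [res_add, shift_splice, res_congr g (agreeTo_splice t w z)]⟩

/-! ### Words read along cycles, and the hierarchy of an automaton. -/

section CycleWord

variable (A B)

open Classical in
/-- The letter that leads from `s` to the next state of the cycle outside `B` through `s`. -/
noncomputable def nextLetter [Nonempty X] (s : S) : X :=
  if h : ∃ x E, A.IsCycleOutside B E ∧ (s, x) ∈ E then h.choose else Classical.arbitrary X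

variable [Nonempty X]

/-- The `n`-th state on the path from `s` along the cycle outside `B`. -/
noncomputable def cycleState (s : S) (n : ℕ) : S :=
  (fun q => A.trans q (A.nextLetter B q))^[n] s

/-- The infinite word read along the cycle outside `B` through `s`. -/
noncomputable def cycleWord (s : S) : Stream' X := fun n => A.nextLetter B (A.cycleState B s n)

theorem stateAt_cycleWord (s : S) (n : ℕ) :
    A.stateAt s (A.cycleWord B s) n = A.cycleState B s n := by
  induction n with
  | zero => rfl
  | succ n ih =>
    rw [stateAt_succ, ih, cycleState, cycleState, Function.iterate_succ_apply']
    rfl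

theorem shift_cycleWord (s : S) (t : ℕ) :
    shift t (A.cycleWord B s) = A.cycleWord B (A.cycleState B s t) := by
  funext i
  change A.nextLetter B _ = A.nextLetter B _
  rw [cycleState, cycleState, cycleState, add_comm, Function.iterate_add_apply]

variable {A B}

/-- Disjointness makes the cycle through `s` unique, so the choice is forced. On states off all
cycles the letter may be arbitrary. -/
theorem nextLetter_eq (hdisj : A.DisjointCyclesOutside B) {s : S} {x : X} {E : Set (S × X)}
    (hE : A.IsCycleOutside B E) (hx : (s, x) ∈ E) : A.nextLetter B s = x := by
  have h : ∃ x E, A.IsCycleOutside B E ∧ (s, x) ∈ E := ⟨x, E, hE, hx⟩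
  rw [nextLetter, dif_pos h]
  obtain ⟨F, hF, hy⟩ := h.choose_spec
  have hEF : E = F := by
    by_contra hne
    exact Set.disjoint_left.1 (hdisj E F hE hF hne) ⟨_, hx, rfl⟩ ⟨_, hy, rfl⟩
  subst hEF
  exact hE.1.eq_of_mem hy hx

theorem levelLE_stateAt_of_not_agreeTo (hB : A.IsSubautomaton B)
    (hdisj : A.DisjointCyclesOutside B) {k : ℕ} {s : S} (h : A.LevelLE B (k + 1) s)
    {E : Set (S × X)} (hE : A.IsCycleOutside B E) (hs : s ∈ states E) {z : Stream' X} {t : ℕ}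
    (hz : ¬ AgreeTo t z (A.cycleWord B s)) : A.LevelLE B k (A.stateAt s z t) := by
  have key : ∀ t, (AgreeTo t z (A.cycleWord B s) ∧ A.stateAt s z t ∈ states E) ∨
      A.LevelLE B k (A.stateAt s z t) := by
    intro t
    induction t with
    | zero => exact Or.inl ⟨fun i hi => absurd hi (Nat.not_lt_zero i), hs⟩
    | succ t ih =>
      rcases ih with ⟨hz, hq⟩ | ih
      · have hst : A.stateAt s z t = A.cycleState B s t := by
          rw [A.stateAt_congr s hz, stateAt_cycleWord]
        obtain ⟨⟨q, x⟩, hx, hq⟩ := hq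
        change q = _ at hq
        subst hq
        rw [stateAt_succ]
        by_cases hw : z t = x
        · refine Or.inl ⟨fun i hi => ?_, ?_⟩
          · rcases Nat.lt_succ_iff_lt_or_eq.1 hi with hi | rfl
            · exact hz i hi
            · change _ = A.nextLetter B _
              rw [← hst, hw, nextLetter_eq hdisj hE hx]
          · rw [hw]
            exact hE.1.trans_mem hx
        · exact Or.inr ((h.stateAt z t).trans_of_ne hB hdisj hE hx hw)
      · exact Or.inr (ih.trans _)
  rcases key t with h | h
  exacts [absurd h.1 hz, h]

end CycleWord

/-- The letters `s`, `s⁻¹` with `s` of level at most `k` and the elements of the nucleus form a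
hierarchy. -/
theorem exists_letterHierarchy [Finite S] [Finite X] [Nonempty X] (hB : A.IsSubautomaton B)
    (hdisj : A.DisjointCyclesOutside B) (hcontr : IsContracting (A.groupOf B)) :
    ∃ H : LetterHierarchy X, ∀ k s, A.LevelLE B k s → A.aut s ∈ H.L k ∧ (A.aut s)⁻¹ ∈ H.L k := by
  obtain ⟨N, d, hNf, h1, hinv, hres, hmul, hBN⟩ := exists_nucleus hB hcontr
  set p : S → Stream' X := A.cycleWord B with hp
  -- Images are included because `s⁻¹` follows `s • p s` and outputs `p s`.
  set P₀ : Set (Stream' X) := Set.range p ∪ Set.range fun s => A.aut s • p s with hP₀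
  have hP₀shift : ∀ q ∈ P₀, ∀ t, shift t q ∈ P₀ := by
    rintro _ (⟨s, rfl⟩ | ⟨s, rfl⟩) t
    · exact Or.inl ⟨_, (A.shift_cycleWord B s t).symm⟩
    · refine Or.inr ⟨A.cycleState B s t, ?_⟩
      simp only [hp, shift_smul, res_aut, shift_cycleWord, stateAt_cycleWord]
  -- Translating by `N` makes `P` stable under `N` up to a shift by `d`, since products of two
  -- nucleus elements restrict to `N` after `d` letters.
  set P : Set (Stream' X) := Set.image2 (fun (g : treeAut X) q => g • q) N P₀ with hP
  have hP₀P : P₀ ⊆ P := fun q hq => ⟨1, h1, q, hq, one_smul _ q⟩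
  set L : ℕ → Set (treeAut X) :=
    fun k => {g | ∃ s, A.LevelLE B k s ∧ (g = A.aut s ∨ g = (A.aut s)⁻¹)} ∪ N with hL
  have synced : ∀ {k : ℕ} {s : S}, A.LevelLE B (k + 1) s → ∀ {E}, A.IsCycleOutside B E →
      s ∈ states E → ∀ z t, ¬ AgreeTo t z (p s) → A.LevelLE B k (A.stateAt s z t) :=
    fun hs _ hE hsE z t hz => levelLE_stateAt_of_not_agreeTo hB hdisj hs hE hsE hz
  -- Within `Nat.card S` steps the path enters `B` or meets a cycle; in the latter case it is then
  -- still on that cycle or has left it and dropped a level.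
  have tri : ∀ {k : ℕ} {s : S}, A.LevelLE B (k + 1) s → ∀ w,
      A.stateAt s w (Nat.card S) ∈ B ∨ A.LevelLE B k (A.stateAt s w (Nat.card S)) ∨
        ∃ E, A.IsCycleOutside B E ∧ A.stateAt s w (Nat.card S) ∈ states E := by
    intro k s hs w
    rcases A.stateAt_card_mem_or_exists_cycle hB s w with h | ⟨i, hi, E, hE, hiE⟩
    · exact Or.inl h
    · have := stateAt_mem_states_or_levelLE hB hdisj (hs.stateAt w i) hE hiE (shift i w)
        (Nat.card S - i)
      rw [← stateAt_add, Nat.add_sub_cancel' hi] at this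
      exact Or.inr (this.symm.imp_right fun h => ⟨E, hE, h⟩)
  have zero : ∀ {s : S}, A.LevelLE B 0 s → ∀ w, A.stateAt s w (Nat.card S) ∈ B := by
    intro s hs w
    rcases A.stateAt_card_mem_or_exists_cycle hB s w with h | ⟨i, hi, E, hE, hiE⟩
    exacts [h, ((hs.stateAt w i).notMem_states hE hiE).elim]
  refine ⟨{ N := N, P := P, L := L, c := Nat.card S, d := d, finite_N := hNf
            finite_P := hNf.image2 _ ((Set.finite_range _).union (Set.finite_range _))
            one_mem_N := h1, inv_mem_N := hinv, res_mem_N := hres, res_mul_mem_N := hmul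
            shift_mem_P := ?_, shift_smul_mem_P := ?_, N_subset_L := Set.subset_union_right
            L_subset_succ := ?_, res_mem_L := ?_, res_L_zero := ?_, res_L_succ := ?_ }, ?_⟩
  · rintro _ ⟨g, hg, q, hq, rfl⟩ t
    exact ⟨res g q t, hres g hg q t, shift t q, hP₀shift q hq t, (shift_smul g q t).symm⟩
  · rintro g hg _ ⟨h, hh, q, hq, rfl⟩
    refine ⟨res (g * h) q d, hmul g hg h hh q, shift d q, hP₀shift q hq d, ?_⟩
    dsimp only
    rw [← shift_smul, mul_smul]
  · rintro k g (⟨s, hs, h⟩ | h)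
    exacts [Or.inl ⟨s, hs.mono (Nat.le_succ k), h⟩, Or.inr h]
  · rintro k g (⟨s, hs, rfl | rfl⟩ | h) w t
    · exact Or.inl ⟨_, hs.stateAt w t, Or.inl (A.res_aut s w t)⟩
    · exact Or.inl ⟨_, hs.stateAt _ t, Or.inr (A.res_aut_inv s w t)⟩
    · exact Or.inr (hres g h w t)
  · rintro g (⟨s, hs, rfl | rfl⟩ | h) w
    · rw [res_aut]
      exact hBN _ (zero hs w)
    · rw [res_aut_inv]
      exact hinv _ (hBN _ (zero hs _))
    · exact hres g h w _
  · rintro k g (⟨s, hs, rfl | rfl⟩ | h) w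
    · rw [res_aut]
      rcases tri hs w with h | h | ⟨E, hE, hsE⟩
      · exact Or.inl (Or.inr (hBN _ h))
      · exact Or.inl (Or.inl ⟨_, h, Or.inl rfl⟩)
      · refine Or.inr ⟨_, hP₀P (Or.inl ⟨A.stateAt s w (Nat.card S), rfl⟩),
          hP₀P (Or.inr ⟨_, rfl⟩), fun z t hz => Or.inl ⟨_, ?_, Or.inl (A.res_aut _ z t)⟩⟩
        exact synced (hs.stateAt _ _) hE hsE z t hz
    · rw [res_aut_inv]
      rcases tri hs ((A.aut s)⁻¹ • w) with h | h | ⟨E, hE, hsE⟩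
      · exact Or.inl (Or.inr (hinv _ (hBN _ h)))
      · exact Or.inl (Or.inl ⟨_, h, Or.inr rfl⟩)
      · set q := A.stateAt s ((A.aut s)⁻¹ • w) (Nat.card S)
        refine Or.inr ⟨A.aut q • p q, hP₀P (Or.inr ⟨q, rfl⟩),
          hP₀P (Or.inl ⟨q, (inv_smul_smul _ _).symm⟩), fun z t hz =>
            Or.inl ⟨_, ?_, Or.inr (A.res_aut_inv _ z t)⟩⟩
        refine synced (hs.stateAt _ _) hE hsE _ t fun h => hz ?_
        rwa [← agreeTo_smul (A.aut q), smul_inv_smul] at h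
    · exact Or.inl (Or.inr (hres g h w _))
  · exact fun k s hs => ⟨Or.inl ⟨s, hs, Or.inl rfl⟩, Or.inl ⟨s, hs, Or.inr rfl⟩⟩

end InvAutomaton

/-! ### Logarithmic estimates and subexponential growth. -/

section Analysis

theorem one_le_log₂ (n : ℕ) : 1 ≤ log₂ n := by
  unfold log₂
  split_ifs with h
  · exact le_rfl
  · rw [Real.le_logb_iff_rpow_le one_lt_two (by exact_mod_cast (by omega : 0 < n)), Real.rpow_one]
    exact_mod_cast Nat.lt_of_not_le h

theorem clog_mul_succ_le (c n : ℕ) :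
    ((Nat.clog 2 (c * (n + 1)) + 1 : ℕ) : ℝ) ≤ (Nat.clog 2 c + 3 : ℕ) * log₂ n := by
  have h1 : Nat.clog 2 (c * (n + 1)) ≤ Nat.clog 2 c + (Nat.log 2 n + 1) := by
    refine Nat.clog_le_of_le_pow ?_
    rw [pow_add]
    exact Nat.mul_le_mul (Nat.le_pow_clog one_lt_two c) (Nat.lt_pow_succ_log_self one_lt_two n)
  have h2 : (Nat.log 2 n : ℝ) ≤ log₂ n := by
    unfold log₂
    split_ifs with h
    · interval_cases n <;> simp
    · exact_mod_cast Real.natLog_le_logb n 2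
  have h3 := one_le_log₂ n
  have h4 : ((Nat.clog 2 (c * (n + 1)) : ℕ) : ℝ) ≤ Nat.clog 2 c + (Nat.log 2 n + 1) := by
    exact_mod_cast h1
  push_cast
  nlinarith [(Nat.cast_nonneg (Nat.clog 2 c) : (0 : ℝ) ≤ _)]

theorem isLittleO_log₂_pow (m : ℕ) :
    (fun n : ℕ => log₂ n ^ m) =o[Filter.atTop] fun n : ℕ => (n : ℝ) := by
  have h := (Real.isLittleO_pow_log_id_atTop (n := m)).comp_tendsto
    (tendsto_natCast_atTop_atTop (R := ℝ))
  have h' := h.const_mul_left ((Real.log 2)⁻¹ ^ m)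
  refine h'.congr' ?_ (Filter.Eventually.of_forall fun _ => rfl)
  filter_upwards [Filter.eventually_gt_atTop 1] with n hn
  simp only [Function.comp, log₂, if_neg (not_le.2 hn), Real.logb, ← mul_pow]
  rw [div_eq_inv_mul]

/-- Powers of the logarithm are `o(n)`. The condition on `f 0` is needed because `a ^ (C * 0) = 1`
whatever `C` is. -/
theorem subexponentialGrowth_of_le {f : ℕ → ℝ} {x E : ℝ} (hx : 1 < x) (hE : 0 < E) (m : ℕ)
    (hf : ∀ n, f n ≤ x ^ (E * log₂ n ^ m)) (h0 : f 0 ≤ 1) : SubexponentialGrowth f := by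
  intro a ha
  have hlx : 0 < Real.log x := Real.log_pos hx
  have hla : 0 < Real.log a := Real.log_pos ha
  have hx0 : 0 < x := one_pos.trans hx
  have ha0 : 0 < a := one_pos.trans ha
  have apow : ∀ k : ℕ, a ^ k = Real.exp (Real.log a * k) := fun k => by
    rw [← Real.rpow_natCast, Real.rpow_def_of_pos ha0]
  have ho := isLittleO_log₂_pow m
  have hpos : ∀ n, 0 ≤ log₂ n ^ m := fun n => pow_nonneg (zero_le_one.trans (one_le_log₂ n)) m
  refine ⟨?_, fun ⟨_, C, hC, h⟩ => ?_⟩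
  · obtain ⟨K, hK, hKn⟩ := Asymptotics.bound_of_isBigO_nat_atTop ho.isBigO
    obtain ⟨C, hC⟩ := exists_nat_ge (Real.log x * E * K / Real.log a)
    rw [div_le_iff₀ hla] at hC
    refine ⟨C + 1, Nat.succ_pos C, fun n => ?_⟩
    rcases Nat.eq_zero_or_pos n with rfl | hn
    · simpa using h0
    · refine (hf n).trans ?_
      have hb := hKn (x := n) (by positivity)
      rw [Real.norm_of_nonneg (hpos n), Real.norm_of_nonneg (Nat.cast_nonneg n)] at hb
      dsimp only
      rw [apow, Real.rpow_def_of_pos hx0, Real.exp_le_exp]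
      have hn0 : (0 : ℝ) ≤ n := Nat.cast_nonneg n
      calc Real.log x * (E * log₂ n ^ m) ≤ Real.log x * (E * (K * n)) := by gcongr
        _ = Real.log x * E * K * n := by ring
        _ ≤ C * Real.log a * n := by gcongr
        _ ≤ Real.log a * ((C + 1) * n : ℕ) := by
            push_cast
            nlinarith [mul_nonneg hla.le hn0]
  · have hC0 : (0 : ℝ) < C := by exact_mod_cast hC
    -- With this `ε` the upper bound on the exponent is half of `Real.log a * n`, a contradiction.
    set ε := Real.log a / (2 * (Real.log x * E * C)) with hε
    have hε0 : 0 < ε := by positivity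
    have ht : Filter.Tendsto (fun n : ℕ => C * n) Filter.atTop Filter.atTop :=
      Filter.tendsto_id.const_mul_atTop' hC
    obtain ⟨n, hb, hn⟩ := ((ht.eventually (ho.bound hε0)).and (Filter.eventually_gt_atTop 0)).exists
    rw [Real.norm_of_nonneg (hpos _), Real.norm_of_nonneg (Nat.cast_nonneg _)] at hb
    have h1 := (h n).trans (hf (C * n))
    dsimp only at h1
    rw [apow, Real.rpow_def_of_pos hx0, Real.exp_le_exp] at h1
    have hn0 : (0 : ℝ) < n := by exact_mod_cast hn
    have h2 : Real.log x * (E * log₂ (C * n) ^ m) ≤ Real.log x * (E * (ε * (C * n : ℕ))) := by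
      gcongr
    have h3 : Real.log x * (E * (ε * (C * n : ℕ))) = Real.log a * n / 2 := by
      rw [hε]
      push_cast
      field_simp
    nlinarith [mul_pos hla hn0]

end Analysis

/-! ### From walks in the Schreier graph to words in the letters. -/

theorem exists_mem_pow_of_mem_group {S X : Type*} {A : InvAutomaton S X} {L : Set (treeAut X)}
    (hL : ∀ s, A.aut s ∈ L ∧ (A.aut s)⁻¹ ∈ L) {t : Equiv.Perm (Stream' X)} (ht : t ∈ A.group) :
    ∃ g : treeAut X, g.1 = t ∧ (∃ l : ℕ, g ∈ L ^ l) ∧ ∃ l : ℕ, g⁻¹ ∈ L ^ l := by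
  induction ht using Subgroup.closure_induction with
  | mem t ht =>
    obtain ⟨s, -, rfl⟩ := ht
    exact ⟨A.aut s, rfl, ⟨1, by simpa using (hL s).1⟩, ⟨1, by rw [pow_one]; exact (hL s).2⟩⟩
  | one => exact ⟨1, rfl, ⟨0, by simp⟩, ⟨0, by simp⟩⟩
  | mul x y _ _ ihx ihy =>
    obtain ⟨g, rfl, ⟨l, hl⟩, ⟨k, hk⟩⟩ := ihx
    obtain ⟨g', rfl, ⟨l', hl'⟩, ⟨k', hk'⟩⟩ := ihy
    refine ⟨g * g', rfl, ⟨l + l', ?_⟩, ⟨k' + k, ?_⟩⟩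
    · rw [pow_add]
      exact Set.mul_mem_mul hl hl'
    · rw [pow_add, mul_inv_rev]
      exact Set.mul_mem_mul hk' hk
  | inv x _ ih =>
    obtain ⟨g, rfl, hl, hk⟩ := ih
    exact ⟨g⁻¹, rfl, hk, by rwa [inv_inv]⟩

theorem exists_smul_eq_of_walk {X : Type*} {G : Subgroup (Equiv.Perm (Stream' X))}
    {T : Set (Equiv.Perm (Stream' X))} {L : Set (treeAut X)} {c : ℕ}
    (hT : ∀ t, t ∈ T ∨ t⁻¹ ∈ T → ∃ g : treeAut X, g.1 = t ∧ g ∈ L ^ c) {w : Stream' X}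
    {v u : MulAction.orbit G w} (p : (schreierGraph G T w).Walk v u) :
    ∃ g ∈ L ^ (c * p.length), g • v.1 = u.1 := by
  induction p with
  | nil => exact ⟨1, by simp, one_smul _ _⟩
  | cons h p ih =>
    obtain ⟨g, hg, hgu⟩ := ih
    obtain ⟨-, t, ht, htv⟩ := h
    obtain ⟨g', rfl, hg'⟩ := hT t ht
    refine ⟨g * g', ?_, ?_⟩
    · change _ ∈ L ^ (c * (p.length + 1))
      rw [mul_add, mul_one, pow_add]
      exact Set.mul_mem_mul hg hg'
    · rw [mul_smul, ← hgu, ← htv]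
      rfl

theorem theorem3 {S X : Type*} [Finite S] [Fintype X] [Nontrivial X]
    (A : InvAutomaton S X) (hA : A.Minimized)
    (B : Set S) (hB : A.IsSubautomaton B)
    (hdisj : A.DisjointCyclesOutside B)
    (hcontr : IsContracting (A.groupOf B))
    (m : ℕ) (hm : A.IsMaxConnectedCycles B m)
    (T : Set (Equiv.Perm (Stream' X))) (hT : T.Finite) (hgen : Subgroup.closure T = A.group) :
    ∃ C : ℝ, 0 < C ∧ ∀ (w : Stream' X) (v : MulAction.orbit A.group w),
      (∀ n : ℕ, (graphBall (schreierGraph A.group T w) v n).Finite) ∧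
      SubexponentialGrowth (growthFun (schreierGraph A.group T w) v) ∧
      ∀ n : ℕ, growthFun (schreierGraph A.group T w) v n
        ≤ (Fintype.card X : ℝ) ^ (C * log₂ n ^ (m + 1)) := by
  obtain ⟨H, hH⟩ := InvAutomaton.exists_letterHierarchy hB hdisj hcontr
  have hL := fun s => hH m s (hm.levelLE s)
  have hmono : ∀ {l k : ℕ}, l ≤ k → H.L m ^ l ⊆ H.L m ^ k := fun h =>
    Set.pow_subset_pow_right (H.one_mem_L m) h
  -- One length `c` serves all generators: shorter words are padded with `1`.
  obtain ⟨c, hc, hcT⟩ : ∃ c, 1 ≤ c ∧ ∀ t, t ∈ T ∨ t⁻¹ ∈ T →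
      ∃ g : treeAut X, g.1 = t ∧ g ∈ H.L m ^ c := by
    have : ∀ t ∈ T ∪ T⁻¹, ∀ᶠ c in Filter.atTop, ∃ g : treeAut X, g.1 = t ∧ g ∈ H.L m ^ c := by
      intro t ht
      have htG : t ∈ A.group := by
        rw [← hgen]
        rcases ht with ht | ht
        exacts [Subgroup.subset_closure ht, inv_mem_iff.1 (Subgroup.subset_closure ht)]
      obtain ⟨g, rfl, ⟨l, hl⟩, -⟩ := exists_mem_pow_of_mem_group hL htG
      filter_upwards [Filter.eventually_ge_atTop l] with c hlc
      exact ⟨g, rfl, hmono hlc hl⟩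
    exact ((Filter.eventually_ge_atTop 1).and
      ((Filter.eventually_all_finite (hT.union hT.inv)).2 this)).exists
  obtain ⟨C, hC⟩ := H.exists_orbitBound (m + 1)
  have hX : 1 < (Fintype.card X : ℝ) := by exact_mod_cast Fintype.one_lt_card
  -- The factor comes from `clog_mul_succ_le`; the summand `1` only ensures positivity.
  set E : ℝ := C * (Nat.clog 2 c + 3 : ℕ) ^ (m + 1) + 1 with hE
  have hE0 : 0 < E := by positivity
  refine ⟨E, hE0, fun w v => ?_⟩
  set Γ := schreierGraph A.group T w
  have hball : ∀ n : ℕ, ∃ s : Finset (Stream' X),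
      s.card ≤ Fintype.card X ^ (C * (Nat.clog 2 (c * (n + 1)) + 1) ^ (m + 1)) ∧
      Subtype.val '' graphBall Γ v n ⊆ s := by
    intro n
    -- The orbit bound needs a positive word length, hence `n + 1`, which covers `n = 0`.
    obtain ⟨s, hs, hgs⟩ := hC (c * (n + 1)) (Nat.mul_pos hc (Nat.succ_pos n)) v.1
    refine ⟨s, hs, ?_⟩
    rintro _ ⟨u, hu, rfl⟩
    have hu' : Γ.edist v u ≤ n := hu
    obtain ⟨p, hp⟩ := SimpleGraph.exists_walk_of_edist_ne_top
      (ne_top_of_le_ne_top (ENat.natCast_ne_top n) hu')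
    rw [← hp, Nat.cast_le] at hu'
    obtain ⟨g, hg, hgu⟩ := exists_smul_eq_of_walk hcT p
    rw [← hgu]
    exact hgs g (hmono (Nat.mul_le_mul_left c (hu'.trans (Nat.le_succ n))) hg)
  have hbound : ∀ n, growthFun Γ v n ≤ (Fintype.card X : ℝ) ^ (E * log₂ n ^ (m + 1)) := by
    intro n
    obtain ⟨s, hs, hsub⟩ := hball n
    have h1 : (graphBall Γ v n).ncard ≤ s.card := by
      rw [← Set.ncard_image_of_injective _ Subtype.val_injective, ← Set.ncard_coe_finset]
      exact Set.ncard_le_ncard hsub s.finite_toSet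
    have h2 : growthFun Γ v n ≤ (Fintype.card X : ℝ) ^
        (C * (Nat.clog 2 (c * (n + 1)) + 1) ^ (m + 1)) := by
      unfold growthFun
      exact_mod_cast h1.trans hs
    refine h2.trans ?_
    rw [← Real.rpow_natCast]
    refine Real.rpow_le_rpow_of_exponent_le hX.le ?_
    have h3 := pow_le_pow_left₀ (Nat.cast_nonneg _) (clog_mul_succ_le c n) (m + 1)
    have h4 : 0 ≤ log₂ n ^ (m + 1) := pow_nonneg (zero_le_one.trans (one_le_log₂ n)) _
    rw [mul_pow] at h3
    calc _ = (C : ℝ) * ((Nat.clog 2 (c * (n + 1)) + 1 : ℕ) : ℝ) ^ (m + 1) := by push_cast; rfl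
      _ ≤ C * (((Nat.clog 2 c + 3 : ℕ) : ℝ) ^ (m + 1) * log₂ n ^ (m + 1)) := by gcongr
      _ ≤ E * log₂ n ^ (m + 1) := by rw [hE, add_mul, mul_assoc, one_mul]; linarith
  refine ⟨fun n => ?_, subexponentialGrowth_of_le hX hE0 (m + 1) hbound ?_, hbound⟩
  · obtain ⟨s, -, hsub⟩ := hball n
    exact (s.finite_toSet.subset hsub).of_finite_image Subtype.val_injective.injOn
  · have : graphBall Γ v 0 = {v} := by
      ext u
      change Γ.edist v u ≤ (0 : ℕ) ↔ u = v
      rw [Nat.cast_zero, nonpos_iff_eq_zero, SimpleGraph.edist_eq_zero_iff, eq_comm]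
    simp [growthFun, this]
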